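/- Let $A,B$ be finite-dimensional complex Hilbert spaces. A state on a Hilbert space is a positive semidefinite operator of trace $1$. For positive semidefinite $X$ and $p\in\mathbb R$, $X^p$ is the power taken on the support of $X$ (the orthogonal complement of $\ker X$). Write $X\sim Y$ if $X,Y$ have the same support. For $\alpha>1$, a state $\rho$ and a positive semidefinite $\sigma$, let $D_\alpha(\rho\|\sigma)=\frac1{\alpha-1}\log\operatorname{tr}[\rho^\alpha\sigma^{1-\alpha}]$ if $\ker\sigma\subseteq\ker\rho$, and $D_\alpha(\rho\|\sigma)=\infty$ otherwise. For a state $\rho_{AB}$ on $A\otimes B$ with marginals $\rho_A,\rho_B$, let $I_\alpha^{\downarrow\downarrow}(A:B)_\rho=\inf_{\sigma_A,\tau_B}D_\alpha(\rho_{AB}\|\sigma_A\otimes\tau_B)$, the infimum being over all states $\sigma_A$ on $A$ and $\tau_B$ on $B$. For positive semidefinite $X,Y$ with $X\sim Y$, $Y\ne0$, let $d_H(X,Y)=\log(M(X/Y)M(Y/X))$ with $M(X/Y)=\inf\{\beta\in\mathbb R: X\le\beta Y\}$; let $d_H(0,0)=0$, and $d_H(X,Y)=\infty$ in all other cases (Hilbert's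 projective metric). Let $\alpha\in(1,2]$, let $\rho_{AB}$ be a state on $A\otimes B$, let $(\hat\sigma_A,\hat\tau_B)$ be a minimizer of $D_\alpha(\rho_{AB}\|\sigma_A\otimes\tau_B)$ over all pairs of states, and let $\sigma_A^{(0)}$ be a state with $\sigma_A^{(0)}\sim\rho_A$. For $n\in\mathbb N=\{0,1,2,\dots\}$ define $$\tau_B^{(n)}=\frac{(\operatorname{tr}_A[\rho_{AB}^\alpha(\sigma_A^{(n)})^{1-\alpha}])^{1/\alpha}}{\operatorname{tr}[(\operatorname{tr}_A[\rho_{AB}^\alpha(\sigma_A^{(n)})^{1-\alpha}])^{1/\alpha}]},\qquad \sigma_A^{(n+1)}=\frac{(\operatorname{tr}_B[\rho_{AB}^\alpha(\tau_B^{(n)})^{1-\alpha}])^{1/\alpha}}{\operatorname{tr}[(\operatorname{tr}_B[\rho_{AB}^\alpha(\tau_B^{(n)})^{1-\alpha}])^{1/\alpha}]},\qquad x_n=D_\alpha(\rho_{AB}\|\sigma_A^{(n)}\otimes\tau_B^{(n)}),$$ and let $\gamma=|1-\frac1\alpha|$. Then all $x_n$, $I_\alpha^{\downarrow\downarrow}(A:B)_\rho$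 and $d_H(\sigma_A^{(0)},\hat\sigma_A)$ are finite, and the following hold. (a) For all $n\in\mathbb N$, $$|x_n-I_\alpha^{\downarrow\downarrow}(A:B)_\rho|\le\frac1{|\alpha-1|}\Big(\exp\big(|\alpha-1|(1+\gamma)\gamma^{2n}d_H(\sigma_A^{(0)},\hat\sigma_A)\big)-1\Big).$$ In particular $|x_n-I_\alpha^{\downarrow\downarrow}(A:B)_\rho|=O(\gamma^{2n})$ as $n\to\infty$. (b) Suppose $\rho_{AB}$ is positive definite. Then the maximum $$m=\max_{\phi,\psi\in A,\ \|\phi\|=\|\psi\|=1}\big\|\langle\phi|\rho_{AB}^\alpha|\phi\rangle^{-\frac12}\langle\psi|\rho_{AB}^\alpha|\psi\rangle\langle\phi|\rho_{AB}^\alpha|\phi\rangle^{-\frac12}\big\|_\infty\cdot\big\|\langle\psi|\rho_{AB}^\alpha|\psi\rangle^{-\frac12}\langle\phi|\rho_{AB}^\alpha|\phi\rangle\langle\psi|\rho_{AB}^\alpha|\psi\rangle^{-\frac12}\big\|_\infty$$ is attained (here $\langle\phi|\rho_{AB}^\alpha|\phi\rangle$ is an operator on $B$ and $\|\cdot\|_\infty$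 is the operator norm), $\kappa=\tanh(\frac14\log m)$ lies in $[0,1)$, and for all $n\in\mathbb N$, $$|x_n-I_\alpha^{\downarrow\downarrow}(A:B)_\rho|\le\frac1{|\alpha-1|}\Big(\exp\big(|\alpha-1|(1+\gamma\kappa)(\gamma\kappa)^{2n}d_H(\sigma_A^{(0)},\hat\sigma_A)\big)-1\Big).$$ In particular $|x_n-I_\alpha^{\downarrow\downarrow}(A:B)_\rho|=O((\gamma\kappa)^{2n})$ as $n\to\infty$. -/

import Mathlib

open scoped ComplexOrder

noncomputable section

namespace PetzMI

/-! ### Hilbert's projective metric of a cone -/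

section Cone

variable {V : Type*} [AddCommGroup V] [Module ℝ V]

/-- The order induced by the cone `C`: `x ≤_C y` iff `y - x ∈ C`. -/
def ConeLE (C : Set V) (x y : V) : Prop := y - x ∈ C

/-- `y` dominates `x` with respect to the cone `C`. -/
def ConeDominates (C : Set V) (y x : V) : Prop :=
  ∃ s t : ℝ, ConeLE C (s • y) x ∧ ConeLE C x (t • y)

/-- `x` and `y` dominate each other. -/
def ConeEquiv (C : Set V) (x y : V) : Prop :=
  ConeDominates C y x ∧ ConeDominates C x y

/-- `M(x/y) = inf {t : x ≤_C t y}`. -/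
def coneM (C : Set V) (x y : V) : ℝ := sInf {t : ℝ | ConeLE C x (t • y)}

open Classical in
/-- Hilbert's projective metric on the cone `C`, with values in `[0, ∞]`. -/
def hilbertMetric (C : Set V) (x y : V) : EReal :=
  if ConeEquiv C x y ∧ y ≠ 0 then
    ((Real.log (coneM C x y * coneM C y x) : ℝ) : EReal)
  else if x = 0 ∧ y = 0 then 0 else ⊤

end Cone

/-! ### Operators on finite-dimensional Hilbert spaces, as complex matrices -/

section Operators

variable {n : Type*} [Fintype n] [DecidableEq n]

/-- The cone of positive semidefinite operators. -/
def psdCone (n : Type*) [Fintype n] : Set (Matrix n n ℂ) := {X | X.PosSemidef}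

/-- Hilbert's projective metric for positive semidefinite operators. -/
def dH (X Y : Matrix n n ℂ) : EReal := hilbertMetric (psdCone n) X Y

/-- Quantum states (density operators). -/
def IsState (ρ : Matrix n n ℂ) : Prop := ρ.PosSemidef ∧ ρ.trace = 1

/-- The kernel of an operator, as a subspace of the Hilbert space. -/
def opKer (X : Matrix n n ℂ) : Submodule ℂ (EuclideanSpace ℂ n) :=
  LinearMap.ker (Matrix.toEuclideanLin X)

/-- The support of an operator: the orthogonal complement of its kernel. -/
def opSupport (X : Matrix n n ℂ) : Submodule ℂ (EuclideanSpace ℂ n) := (opKer X)ᗮ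

/-- `X ≪ Y`: the kernel of `Y` is contained in the kernel of `X`. -/
def AbsCont (X Y : Matrix n n ℂ) : Prop := opKer Y ≤ opKer X

/-- `X ∼ Y`: the operators have the same support. -/
def SameSupport (X Y : Matrix n n ℂ) : Prop := opSupport X = opSupport Y

/-- `X ⟂ Y`: `X Y = Y X = 0`. -/
def OpPerp (X Y : Matrix n n ℂ) : Prop := X * Y = 0 ∧ Y * X = 0

/-- The real power `X ^ p` of a positive semidefinite operator, taken on the support of `X`:
eigenvalues `x > 0` are sent to `x ^ p`, and the kernel of `X` is kept. -/
def suppPow (X : Matrix n n ℂ) (p : ℝ) : Matrix n n ℂ :=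
  cfc (fun x : ℝ => if x = 0 then 0 else x ^ p) X

/-- The operator norm with respect to the Hilbert space norm (the Schatten `∞`-norm). -/
def opNorm (X : Matrix n n ℂ) : ℝ := ‖Matrix.toEuclideanCLM (𝕜 := ℂ) X‖

open Classical in
/-- The Petz divergence of order `α` (for `α ≥ 0`, `α ≠ 1`) of a state `ρ` relative to a
positive semidefinite `σ`. -/
def petzD (α : ℝ) (ρ σ : Matrix n n ℂ) : EReal :=
  if (α < 1 ∧ ¬ OpPerp ρ σ) ∨ AbsCont ρ σ then
    ((1 / (α - 1) * Real.log ((suppPow ρ α * suppPow σ (1 - α)).trace.re) : ℝ) : EReal)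
  else ⊤

end Operators

/-! ### Bipartite systems -/

section Bipartite

variable {a b : Type*} [Fintype a] [DecidableEq a] [Fintype b] [DecidableEq b]

/-- The partial trace over the first system. -/
def trA (X : Matrix (a × b) (a × b) ℂ) : Matrix b b ℂ :=
  Matrix.of fun j j' => ∑ i, X (i, j) (i, j')

/-- The partial trace over the second system. -/
def trB (X : Matrix (a × b) (a × b) ℂ) : Matrix a a ℂ :=
  Matrix.of fun i i' => ∑ j, X (i, j) (i', j)

/-- The doubly minimized Petz Rényi mutual information of order `α` (`α ≥ 0`, `α ≠ 1`). -/
def prmi (α : ℝ) (ρ : Matrix (a × b) (a × b) ℂ) : EReal :=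
  sInf {v : EReal | ∃ (σ : Matrix a a ℂ) (τ : Matrix b b ℂ), IsState σ ∧ IsState τ ∧
    v = petzD α ρ (Matrix.kronecker σ τ)}

/-- `(σ', τ')` minimizes the Petz divergence of order `α` of `ρ` relative to `σ ⊗ τ` over all
pairs of states `(σ, τ)`. -/
def IsMinimizer (α : ℝ) (ρ : Matrix (a × b) (a × b) ℂ)
    (σ' : Matrix a a ℂ) (τ' : Matrix b b ℂ) : Prop :=
  IsState σ' ∧ IsState τ' ∧
    ∀ (σ : Matrix a a ℂ) (τ : Matrix b b ℂ), IsState σ → IsState τ →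
      petzD α ρ (Matrix.kronecker σ' τ') ≤ petzD α ρ (Matrix.kronecker σ τ)

/-- `tr_A[ρ ^ α σ ^ (1 - α)] ^ (1 / α)`, before normalization. -/
def preAB (α : ℝ) (ρ : Matrix (a × b) (a × b) ℂ) (σ : Matrix a a ℂ) : Matrix b b ℂ :=
  suppPow (trA (suppPow ρ α * Matrix.kronecker (suppPow σ (1 - α)) (1 : Matrix b b ℂ))) (1 / α)

/-- `tr_B[ρ ^ α τ ^ (1 - α)] ^ (1 / α)`, before normalization. -/
def preBA (α : ℝ) (ρ : Matrix (a × b) (a × b) ℂ) (τ : Matrix b b ℂ) : Matrix a a ℂ :=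
  suppPow (trB (suppPow ρ α * Matrix.kronecker (1 : Matrix a a ℂ) (suppPow τ (1 - α)))) (1 / α)

/-- The update map from states of `A` to states of `B`. -/
def stepAB (α : ℝ) (ρ : Matrix (a × b) (a × b) ℂ) (σ : Matrix a a ℂ) : Matrix b b ℂ :=
  (preAB α ρ σ).trace⁻¹ • preAB α ρ σ

/-- The update map from states of `B` to states of `A`. -/
def stepBA (α : ℝ) (ρ : Matrix (a × b) (a × b) ℂ) (τ : Matrix b b ℂ) : Matrix a a ℂ :=
  (preBA α ρ τ).trace⁻¹ • preBA α ρ τ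

/-- The iterates on `A` of alternating minimization started at `σ₀`. -/
def iterA (α : ℝ) (ρ : Matrix (a × b) (a × b) ℂ) (σ₀ : Matrix a a ℂ) : ℕ → Matrix a a ℂ
  | 0 => σ₀
  | k + 1 => stepBA α ρ (stepAB α ρ (iterA α ρ σ₀ k))

/-- The iterates on `B` of alternating minimization started at `σ₀`. -/
def iterB (α : ℝ) (ρ : Matrix (a × b) (a × b) ℂ) (σ₀ : Matrix a a ℂ) (k : ℕ) : Matrix b b ℂ :=
  stepAB α ρ (iterA α ρ σ₀ k)

/-- The objective function values of alternating minimization started at `σ₀`. -/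
def objVal (α : ℝ) (ρ : Matrix (a × b) (a × b) ℂ) (σ₀ : Matrix a a ℂ) (k : ℕ) : EReal :=
  petzD α ρ (Matrix.kronecker (iterA α ρ σ₀ k) (iterB α ρ σ₀ k))

/-- The operator `⟨φ| Z |φ⟩` on `B`, for `φ` in `A` and an operator `Z` on `A ⊗ B`. -/
def sandwich (Z : Matrix (a × b) (a × b) ℂ) (φ : EuclideanSpace ℂ a) : Matrix b b ℂ :=
  Matrix.of fun j j' => ∑ i, ∑ i', star (φ i) * Z (i, j) (i', j') * φ i'

/-- `‖⟨φ|Z|φ⟩^{-1/2} ⟨ψ|Z|ψ⟩ ⟨φ|Z|φ⟩^{-1/2}‖_∞`. -/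
def ratioNorm (Z : Matrix (a × b) (a × b) ℂ) (φ ψ : EuclideanSpace ℂ a) : ℝ :=
  opNorm (suppPow (sandwich Z φ) (-1 / 2) * sandwich Z ψ * suppPow (sandwich Z φ) (-1 / 2))

/-- The values over which the maximum in the definition of `δ` is taken. -/
def deltaSet (α : ℝ) (ρ : Matrix (a × b) (a × b) ℂ) : Set ℝ :=
  {m : ℝ | ∃ φ ψ : EuclideanSpace ℂ a, ‖φ‖ = 1 ∧ ‖ψ‖ = 1 ∧
    m = ratioNorm (suppPow ρ α) φ ψ * ratioNorm (suppPow ρ α) ψ φ}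

/-- `δ`, the logarithm of the maximum of `deltaSet`. -/
def delta (α : ℝ) (ρ : Matrix (a × b) (a × b) ℂ) : ℝ := Real.log (sSup (deltaSet α ρ))

/-- `κ = tanh (δ / 4)`. -/
def kappa (α : ℝ) (ρ : Matrix (a × b) (a × b) ℂ) : ℝ := Real.tanh (delta α ρ / 4)

end Bipartite

end PetzMI

end

open PetzMI

/-!
Write `R = ρ ^ α` and `p = α - 1 ∈ (0, 1]`. The objective function is
`(1 / p) log tr[R (σ ^ (-p) ⊗ τ ^ (-p))]`, and alternating minimization composes the two maps
`σ ↦ tr_A[R σ ^ (-p)] ^ (1 / α)` and `τ ↦ tr_B[R τ ^ (-p)] ^ (1 / α)`, up to normalization.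
Hilbert's projective metric does not see the normalization, and each map contracts it by
`γ = p / α = 1 - 1 / α`: by the Löwner–Heinz inequality and the antitonicity of the inverse, the
powers `-p` and `1 / α` contract by `p` and `1 / α` (`HilbertLE.suppPow_neg`,
`HilbertLE.suppPow`), and the partial trace map, being positive and linear, does not expand
(`contractsBy_one`). If `ρ` is positive definite, the partial trace maps in both directions have
image of finite projective diameter `δ = log m`, and the Birkhoff–Hopf theorem
(`CrossRatioLE.hilbertLE`) provides the additional factor `κ = tanh (δ / 4)`. The diameter is
encoded as a bound on cross ratios of the bilinear form `tr[R (X ⊗ T)]`, which is symmetric in the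
two systems, so the maximum over unit vectors of `A` controls both directions
(`crossRatioLE_partialMap`, `contractsBy_kappa`).

A minimizer `(σ', τ')` is a fixed point (`IsMinimizer.eq_stepAB`). This is the equality case of
the reverse Hölder inequality `tr[Y τ ^ (-p)] ≥ (tr Y ^ (1 / α)) ^ α`, which reduces in eigenbases
of `Y` and `τ` to the strict Bernoulli inequality (`eq_of_trace_mul_suppPow_le`). So after `n`
rounds the iterates have distances at most `r ^ (2 n) d` and `r ^ (2 n + 1) d` from the minimizer,
where `r` is `γ` or `γ κ` and `d` is the initial distance. For states, distance `e` gives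
`σ ^ (-p) ≤ exp (p e) σ' ^ (-p)`, so the objective exceeds its minimum by at most
`(1 + r) r ^ (2 n) d` (`exists_objVal_bound`); this is stronger than the exponential bound.

Supports are handled through the relation `Dom X Y`, meaning `X ≤ t Y` for some `t ≥ 0`.
Statements about system `B` follow from those about `A` by exchanging the systems (`swapSys`).
-/

namespace PetzMI

open scoped MatrixOrder Kronecker
open Matrix

-- The sections below share their finiteness and decidability instances.
set_option linter.unusedSectionVars false

/-! ### Functional calculus of Hermitian matrices -/

section FunctionalCalculus

variable {n m : Type*} [Fintype n] [DecidableEq n] [Fintype m] [DecidableEq m]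
  {X Y : Matrix n n ℂ}

lemma continuousOn_spectrum (X : Matrix n n ℂ) (f : ℝ → ℝ) : ContinuousOn f (spectrum ℝ X) :=
  X.finite_real_spectrum.continuousOn f

lemma cfc_mul_matrix (f g : ℝ → ℝ) (X : Matrix n n ℂ) :
    cfc (fun x => f x * g x) X = cfc f X * cfc g X :=
  cfc_mul f g X (continuousOn_spectrum X f) (continuousOn_spectrum X g)

lemma cfc_comp_matrix (g f : ℝ → ℝ) (hX : 0 ≤ X) :
    cfc g (cfc f X) = cfc (fun x => g (f x)) X :=
  (cfc_comp g f X (IsSelfAdjoint.of_nonneg hX)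
    ((X.finite_real_spectrum.image f).continuousOn g) (continuousOn_spectrum X f)).symm

lemma cfc_le_cfc (f g : ℝ → ℝ) (h : ∀ x ∈ spectrum ℝ X, f x ≤ g x) : cfc f X ≤ cfc g X :=
  cfc_mono h (continuousOn_spectrum X f) (continuousOn_spectrum X g)

lemma spectrum_nonneg (hX : 0 ≤ X) {x : ℝ} (hx : x ∈ spectrum ℝ X) : 0 ≤ x :=
  spectrum_nonneg_of_nonneg hX hx

/-- As spectra are finite, functional calculus is evaluation of an interpolation polynomial, which
may be prescribed on a further finite set. -/
lemma exists_polynomial_cfc_eq (f : ℝ → ℝ) (hX : IsSelfAdjoint X) (s : Set ℝ) (hs : s.Finite) :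
    ∃ q : Polynomial ℝ, (∀ x ∈ s, q.eval x = f x) ∧ cfc f X = Polynomial.aeval X q := by
  have hfin := hs.union X.finite_real_spectrum
  refine ⟨Lagrange.interpolate hfin.toFinset id f, fun x hx => ?_, ?_⟩
  · exact Lagrange.eval_interpolate_at_node (v := id) f Function.injective_id.injOn (by simp [hx])
  · rw [← cfc_polynomial _ X hX]
    refine cfc_congr fun x hx => ?_
    exact (Lagrange.eval_interpolate_at_node (v := id) f Function.injective_id.injOn
      (by simp [hx])).symm

lemma cfc_algHom (f : ℝ → ℝ) (φ : Matrix n n ℂ →ₐ[ℝ] Matrix m m ℂ) (hX : IsSelfAdjoint X)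
    (hφ : IsSelfAdjoint (φ X)) : cfc f (φ X) = φ (cfc f X) := by
  obtain ⟨q, hq, hq'⟩ := exists_polynomial_cfc_eq f hX _ (φ X).finite_real_spectrum
  rw [hq', ← Polynomial.aeval_algHom_apply, ← cfc_polynomial q (φ X) hφ]
  exact cfc_congr fun x hx => (hq x hx).symm

lemma cfc_conj_diagonal (f : ℝ → ℝ) (U : unitaryGroup n ℂ) (d : n → ℝ) :
    cfc f ((U : Matrix n n ℂ) * diagonal (fun i => (d i : ℂ)) * star (U : Matrix n n ℂ)) =
      (U : Matrix n n ℂ) * diagonal (fun i => (f (d i) : ℂ)) * star (U : Matrix n n ℂ) := by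
  set φ : (n → ℂ) →ₐ[ℝ] Matrix n n ℂ :=
    ((Unitary.conjStarAlgAut ℂ (Matrix n n ℂ) U).toAlgEquiv.toAlgHom.restrictScalars ℝ).comp
      (diagonalAlgHom ℝ) with hφ
  have key : ∀ e : n → ℂ, φ e = (U : Matrix n n ℂ) * diagonal e * star (U : Matrix n n ℂ) :=
    fun e => rfl
  have hsa : IsSelfAdjoint (φ fun i => (d i : ℂ)) := by
    rw [key, IsSelfAdjoint, star_mul, star_mul, star_star, mul_assoc, star_eq_conjTranspose,
      star_eq_conjTranspose, diagonal_conjTranspose]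
    congr; ext; simp
  rw [← key, ← key]
  obtain ⟨q, hq, hq'⟩ := exists_polynomial_cfc_eq f hsa _ (Set.finite_range d)
  rw [hq', Polynomial.aeval_algHom_apply]
  congr 1
  ext i
  rw [← hq _ (Set.mem_range_self i)]
  have := Polynomial.aeval_algHom_apply (Pi.evalAlgHom ℝ (fun _ : n => ℂ) i)
    (fun i => (d i : ℂ)) q
  simp only [Pi.evalAlgHom_apply] at this
  rw [← this]
  exact (Polynomial.aeval_algebraMap_apply ℂ (d i) q)

lemma eq_conj_diagonal (hX : IsSelfAdjoint X) :
    ∃ (U : unitaryGroup n ℂ) (d : n → ℝ), (∀ i, d i ∈ spectrum ℝ X) ∧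
      X = (U : Matrix n n ℂ) * diagonal (fun i => (d i : ℂ)) * star (U : Matrix n n ℂ) :=
  have hX' : X.IsHermitian := hX
  ⟨hX'.eigenvectorUnitary, hX'.eigenvalues, hX'.eigenvalues_mem_spectrum_real,
    hX'.spectral_theorem⟩

end FunctionalCalculus

/-! ### Powers on the support and domination -/

section SupportPowers

variable {n m : Type*} [Fintype n] [DecidableEq n] [Fintype m] [DecidableEq m]
  {X Y : Matrix n n ℂ}

lemma suppPow_nonneg (hX : 0 ≤ X) (p : ℝ) : 0 ≤ suppPow X p :=
  cfc_nonneg fun x hx => by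
    split_ifs
    · exact le_rfl
    · exact Real.rpow_nonneg (spectrum_nonneg hX hx) p

lemma suppPow_one (hX : 0 ≤ X) : suppPow X 1 = X := by
  rw [suppPow]
  conv_rhs => rw [← cfc_id' ℝ X (IsSelfAdjoint.of_nonneg hX)]
  refine cfc_congr fun x _ => ?_
  by_cases h : x = 0 <;> simp [h]

lemma suppPow_mul_suppPow (hX : 0 ≤ X) (p q : ℝ) :
    suppPow X p * suppPow X q = suppPow X (p + q) := by
  rw [suppPow, suppPow, suppPow, ← cfc_mul_matrix]
  refine cfc_congr fun x hx => ?_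
  by_cases h : x = 0
  · simp [h]
  · simp [h, Real.rpow_add ((spectrum_nonneg hX hx).lt_of_ne' h)]

lemma suppPow_smul {c : ℝ} (hc : 0 < c) (hX : 0 ≤ X) (p : ℝ) :
    suppPow (c • X) p = c ^ p • suppPow X p := by
  have hsa := IsSelfAdjoint.of_nonneg hX
  rw [suppPow, suppPow, ← cfc_smul _ _ _ (continuousOn_spectrum X _),
    ← cfc_smul_id (R := ℝ) c X hsa, cfc_comp_matrix _ _ hX]
  refine cfc_congr fun x hx => ?_
  by_cases h : x = 0
  · simp [h]
  · simp [h, hc.ne', Real.mul_rpow hc.le (spectrum_nonneg hX hx)]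

lemma suppPow_suppPow (hX : 0 ≤ X) (p q : ℝ) :
    suppPow (suppPow X p) q = suppPow X (p * q) := by
  rw [suppPow, suppPow, cfc_comp_matrix _ _ hX, suppPow]
  refine cfc_congr fun x hx => ?_
  by_cases h : x = 0
  · simp [h]
  · have := (spectrum_nonneg hX hx).lt_of_ne' h
    simp [h, (Real.rpow_pos_of_pos this p).ne', Real.rpow_mul this.le]

lemma suppPow_kronecker {Z : Matrix m m ℂ} (hX : 0 ≤ X) (hZ : 0 ≤ Z) (p : ℝ) :
    suppPow (X ⊗ₖ Z) p = suppPow X p ⊗ₖ suppPow Z p := by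
  obtain ⟨U, d, hd, hXU⟩ := eq_conj_diagonal (IsSelfAdjoint.of_nonneg hX)
  obtain ⟨V, e, he, hZV⟩ := eq_conj_diagonal (IsSelfAdjoint.of_nonneg hZ)
  have hU := U.2
  have hV := V.2
  let W : unitaryGroup (n × m) ℂ :=
    ⟨(U : Matrix n n ℂ) ⊗ₖ (V : Matrix m m ℂ), kronecker_mem_unitary hU hV⟩
  have key : ∀ (f : n → ℝ) (g : m → ℝ),
      ((U : Matrix n n ℂ) * diagonal (fun i => (f i : ℂ)) * star (U : Matrix n n ℂ)) ⊗ₖ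
        ((V : Matrix m m ℂ) * diagonal (fun i => (g i : ℂ)) * star (V : Matrix m m ℂ)) =
      (W : Matrix (n × m) (n × m) ℂ) * diagonal (fun i => ((f i.1 * g i.2 : ℝ) : ℂ)) *
        star (W : Matrix (n × m) (n × m) ℂ) := by
    intro f g
    simp only [W, star_eq_conjTranspose, conjTranspose_kronecker, mul_kronecker_mul]
    rw [diagonal_kronecker_diagonal]
    simp
  conv_lhs => rw [hXU, hZV]
  conv_rhs => rw [hXU, hZV]
  rw [key, suppPow, suppPow, suppPow, cfc_conj_diagonal, cfc_conj_diagonal, cfc_conj_diagonal, key]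
  congr 3
  ext i
  have h1 := spectrum_nonneg hX (hd i.1)
  have h2 := spectrum_nonneg hZ (he i.2)
  by_cases h3 : d i.1 = 0
  · simp [h3]
  by_cases h4 : e i.2 = 0
  · simp [h4]
  simp [h3, h4, Real.mul_rpow h1 h2]

lemma suppPow_submatrix (e : m ≃ n) (hX : IsSelfAdjoint X) (p : ℝ) :
    suppPow (X.submatrix e e) p = (suppPow X p).submatrix e e := by
  have := cfc_algHom (fun x : ℝ => if x = 0 then 0 else x ^ p)
    (reindexAlgEquiv ℝ ℂ e.symm).toAlgHom hX (by
      change (X.submatrix e e)ᴴ = X.submatrix e e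
      rw [conjTranspose_submatrix]; congr 1)
  exact this

/-- The orthogonal projection onto the kernel of `X`. -/
noncomputable def kerProj (X : Matrix n n ℂ) : Matrix n n ℂ :=
  cfc (fun x : ℝ => if x = 0 then 1 else 0) X

lemma kerProj_nonneg (X : Matrix n n ℂ) : 0 ≤ kerProj X :=
  cfc_nonneg fun x _ => by split_ifs <;> norm_num

lemma kerProj_isSelfAdjoint (X : Matrix n n ℂ) : (kerProj X)ᴴ = kerProj X :=
  IsSelfAdjoint.of_nonneg (kerProj_nonneg X)

lemma kerProj_mul_self (X : Matrix n n ℂ) : kerProj X * kerProj X = kerProj X := by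
  rw [kerProj, ← cfc_mul_matrix]
  congr 1; ext x; split_ifs <;> simp

lemma mul_kerProj_self (hX : 0 ≤ X) : X * kerProj X = 0 := by
  conv_lhs => enter [1]; rw [← cfc_id' ℝ X (IsSelfAdjoint.of_nonneg hX)]
  rw [kerProj, ← cfc_mul_matrix, ← cfc_zero ℝ X]
  refine cfc_congr fun x _ => ?_
  by_cases h : x = 0 <;> simp [h]

lemma suppPow_zero_add_kerProj (hX : 0 ≤ X) : suppPow X 0 + kerProj X = 1 := by
  rw [suppPow, kerProj, ← cfc_add _ _ _ (continuousOn_spectrum X _) (continuousOn_spectrum X _),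
    ← cfc_one ℝ X (IsSelfAdjoint.of_nonneg hX)]
  refine cfc_congr fun x _ => ?_
  by_cases h : x = 0 <;> simp [h]

lemma mul_eq_zero_of_conj_eq_zero (hX : 0 ≤ X) {B : Matrix n m ℂ} (h : Bᴴ * X * B = 0) :
    X * B = 0 := by
  obtain ⟨C, rfl⟩ := CStarAlgebra.nonneg_iff_eq_star_mul_self.1 hX
  rw [star_eq_conjTranspose] at *
  have : (C * B)ᴴ * (C * B) = 0 := by
    rw [← h, conjTranspose_mul]; simp only [Matrix.mul_assoc]
  rw [Matrix.mul_assoc, conjTranspose_mul_self_eq_zero.1 this, Matrix.mul_zero]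

/-- `X ≤ t Y` for some `t ≥ 0`. For positive semidefinite matrices this says that the kernel of
`Y` is contained in that of `X`. -/
def Dom (X Y : Matrix n n ℂ) : Prop := ∃ t : ℝ, 0 ≤ t ∧ X ≤ t • Y

lemma Dom.trans {X Y Z : Matrix n n ℂ} (h : Dom X Y) (h' : Dom Y Z) : Dom X Z := by
  obtain ⟨s, hs, h⟩ := h
  obtain ⟨t, ht, h'⟩ := h'
  refine ⟨s * t, mul_nonneg hs ht, h.trans ?_⟩
  rw [mul_smul]
  exact smul_le_smul_of_nonneg_left h' hs

lemma Dom.of_le_smul {t : ℝ} (hY : 0 ≤ Y) (h : X ≤ t • Y) : Dom X Y :=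
  ⟨max t 0, le_max_right _ _, h.trans (smul_le_smul_of_nonneg_right (le_max_left _ _) hY)⟩

lemma conj_le_conj {A B : Matrix n n ℂ} (h : A ≤ B) (C : Matrix n m ℂ) :
    Cᴴ * A * C ≤ Cᴴ * B * C := by
  rw [Matrix.le_iff] at *
  have := h.conjTranspose_mul_mul_same C
  rwa [Matrix.mul_sub, Matrix.sub_mul] at this

lemma Dom.mul_kerProj (hX : 0 ≤ X) (hY : 0 ≤ Y) (h : Dom X Y) : X * kerProj Y = 0 := by
  obtain ⟨t, ht, h⟩ := h
  refine mul_eq_zero_of_conj_eq_zero hX (le_antisymm ?_ ?_)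
  · refine (conj_le_conj h _).trans ?_
    rw [Matrix.mul_assoc, Matrix.smul_mul, mul_kerProj_self hY]
    simp
  · have := conj_le_conj hX (kerProj Y)
    simpa using this

lemma dom_cfc (f g : ℝ → ℝ) (X : Matrix n n ℂ)
    (h : ∀ x ∈ spectrum ℝ X, 0 ≤ g x ∧ (g x = 0 → f x ≤ 0)) : Dom (cfc f X) (cfc g X) := by
  obtain ⟨t, ht⟩ := (X.finite_real_spectrum.image (fun x => f x / g x)).bddAbove
  refine ⟨max t 0, le_max_right _ _, ?_⟩
  rw [← cfc_smul _ _ _ (continuousOn_spectrum X _)]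
  refine cfc_le_cfc _ _ fun x hx => ?_
  obtain ⟨h1, h2⟩ := h x hx
  rcases h1.eq_or_lt with h3 | h3
  · simpa [← h3] using h2 h3.symm
  · have := ht (Set.mem_image_of_mem _ hx)
    rw [smul_eq_mul, ← div_le_iff₀ h3]
    exact this.trans (le_max_left _ _)

lemma dom_suppPow (hX : 0 ≤ X) (p q : ℝ) : Dom (suppPow X p) (suppPow X q) := by
  refine dom_cfc _ _ X fun x hx => ?_
  have h := spectrum_nonneg hX hx
  by_cases h0 : x = 0
  · simp [h0]
  · have := Real.rpow_pos_of_pos (h.lt_of_ne' h0) q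
    simp [h0, this.le, this.ne']

lemma dom_one (hX : 0 ≤ X) : Dom X 1 := by
  have hsa := IsSelfAdjoint.of_nonneg hX
  have := dom_cfc (fun x => x) 1 X (fun x _ => by simp)
  rwa [cfc_id' ℝ X hsa, cfc_one ℝ X hsa] at this

lemma dom_of_mul_kerProj (hX : 0 ≤ X) (hY : 0 ≤ Y) (h : X * kerProj Y = 0) : Dom X Y := by
  have hP := suppPow_zero_add_kerProj hY
  have hPs : (suppPow Y 0)ᴴ = suppPow Y 0 := IsSelfAdjoint.of_nonneg (suppPow_nonneg hY 0)
  have h1 : X * suppPow Y 0 = X := by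
    rw [eq_sub_of_add_eq hP, Matrix.mul_sub, h, Matrix.mul_one, sub_zero]
  have h2 : suppPow Y 0 * X = X := by
    have := congrArg conjTranspose h1
    rwa [conjTranspose_mul, hPs, show Xᴴ = X from IsSelfAdjoint.of_nonneg hX] at this
  obtain ⟨t, ht, h3⟩ := dom_one hX
  have h4 := conj_le_conj h3 (suppPow Y 0)
  rw [hPs, h2, h1, Matrix.mul_smul, Matrix.mul_one, Matrix.smul_mul, suppPow_mul_suppPow hY,
    add_zero] at h4
  have h5 := dom_suppPow hY 0 1
  rw [suppPow_one hY] at h5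
  exact Dom.trans ⟨t, ht, h4⟩ h5

lemma absCont_iff_dom (hX : 0 ≤ X) (hY : 0 ≤ Y) : AbsCont X Y ↔ Dom X Y := by
  have hker : ∀ (Z : Matrix n n ℂ) (v : EuclideanSpace ℂ n), v ∈ opKer Z ↔ Z *ᵥ v.ofLp = 0 := by
    intro Z v
    rw [opKer, LinearMap.mem_ker, ← WithLp.ofLp_eq_zero 2]
    rfl
  constructor
  · intro h
    refine dom_of_mul_kerProj hX hY ?_
    ext i j
    have h1 : WithLp.toLp 2 ((kerProj Y).col j) ∈ opKer Y := by
      rw [hker]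
      ext k
      exact congrFun (congrFun (mul_kerProj_self hY) k) j
    have h2 := (hker _ _).1 (h h1)
    exact congrFun h2 i
  · intro h v hv
    rw [hker] at *
    have h1 : kerProj Y *ᵥ v.ofLp = v.ofLp := by
      have : suppPow Y 0 = suppPow Y (-1) * Y := by
        conv_rhs => enter [2]; rw [← suppPow_one hY]
        rw [suppPow_mul_suppPow hY]; norm_num
      rw [eq_sub_of_add_eq' (suppPow_zero_add_kerProj hY), sub_mulVec, one_mulVec, this,
        ← mulVec_mulVec, hv, mulVec_zero, sub_zero]
    rw [← h1, mulVec_mulVec, h.mul_kerProj hX hY, zero_mulVec]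

lemma sameSupport_iff_dom (hX : 0 ≤ X) (hY : 0 ≤ Y) :
    SameSupport X Y ↔ Dom X Y ∧ Dom Y X := by
  rw [← absCont_iff_dom hX hY, ← absCont_iff_dom hY hX, SameSupport, opSupport, opSupport, AbsCont,
    AbsCont]
  constructor
  · intro h
    have := congrArg Submodule.orthogonal h
    rw [Submodule.orthogonal_orthogonal, Submodule.orthogonal_orthogonal] at this
    exact ⟨this.ge, this.le⟩
  · rintro ⟨h1, h2⟩
    rw [le_antisymm h1 h2]

lemma kerProj_eq_of_dom (hX : 0 ≤ X) (hY : 0 ≤ Y) (h : Dom X Y) (h' : Dom Y X) :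
    kerProj X = kerProj Y := by
  have key : ∀ {X Y : Matrix n n ℂ}, 0 ≤ X → 0 ≤ Y → Dom X Y →
      kerProj X * kerProj Y = kerProj Y := by
    intro X Y hX hY h
    have h1 : suppPow X 0 = suppPow X (-1) * X := by
      conv_rhs => enter [2]; rw [← suppPow_one hX]
      rw [suppPow_mul_suppPow hX]; norm_num
    rw [eq_sub_of_add_eq' (suppPow_zero_add_kerProj hX), Matrix.sub_mul, h1, Matrix.mul_assoc,
      h.mul_kerProj hX hY, Matrix.mul_zero, Matrix.one_mul, sub_zero]
  have h1 := congrArg conjTranspose (key hX hY h)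
  rw [conjTranspose_mul, kerProj_isSelfAdjoint, kerProj_isSelfAdjoint, key hY hX h'] at h1
  exact h1

end SupportPowers

/-! ### The Löwner–Heinz inequality on the support -/

section LoewnerHeinz

variable {n m : Type*} [Fintype n] [DecidableEq n] [Fintype m] [DecidableEq m]
  {X Y : Matrix n n ℂ}

open scoped Matrix.Norms.L2Operator in
/-- The Löwner–Heinz inequality. -/
lemma suppPow_le_suppPow {q : ℝ} (hq : 0 < q) (hq1 : q ≤ 1) (hX : 0 ≤ X) (h : X ≤ Y) :
    suppPow X q ≤ suppPow Y q := by
  have key : ∀ {Z : Matrix n n ℂ}, 0 ≤ Z → suppPow Z q = Z ^ q := by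
    intro Z hZ
    rw [CFC.rpow_eq_cfc_real hZ, suppPow]
    refine cfc_congr fun x _ => ?_
    by_cases h : x = 0 <;> simp [h, hq.ne']
  rw [key hX, key (hX.trans h)]
  exact CFC.rpow_le_rpow ⟨hq.le, hq1⟩ h

open scoped Matrix.Norms.L2Operator in
/-- Negative powers reverse the order on a common support. -/
lemma suppPow_neg_le_suppPow_neg {p c : ℝ} (hp : 0 < p) (hp1 : p ≤ 1) (hc : 0 < c) (hX : 0 ≤ X)
    (hY : 0 ≤ Y) (h : X ≤ c • Y) (hk : kerProj X = kerProj Y) :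
    suppPow Y (-p) ≤ c ^ p • suppPow X (-p) := by
  have hXs := IsSelfAdjoint.of_nonneg hX
  have hYs := IsSelfAdjoint.of_nonneg hY
  -- Filling the common kernel with the eigenvalue `c` makes `X` and `c Y` positive definite and
  -- keeps the inequality; compressing to the support at the end removes the added part.
  set f : ℝ → ℝ := fun x => if x = 0 then c else x with hf
  set g : ℝ → ℝ := fun x => if x = 0 then c else c * x with hg
  have h1 : cfc f X = X + c • kerProj X := by
    conv_rhs => enter [1]; rw [← cfc_id' ℝ X hXs]
    rw [kerProj, ← cfc_smul _ _ _ (continuousOn_spectrum X _),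
      ← cfc_add _ _ _ (continuousOn_spectrum X _) (continuousOn_spectrum X _)]
    refine cfc_congr fun x _ => ?_
    by_cases h : x = 0 <;> simp [hf, h]
  have h2 : cfc g Y = c • Y + c • kerProj Y := by
    rw [kerProj, ← cfc_smul_id (R := ℝ) c Y hYs, ← cfc_smul _ _ _ (continuousOn_spectrum Y _),
      ← cfc_add _ _ _ (continuousOn_spectrum Y _) (continuousOn_spectrum Y _)]
    refine cfc_congr fun x _ => ?_
    by_cases h : x = 0 <;> simp [hg, h]
  have h3 : cfc f X ≤ cfc g Y := by
    rw [h1, h2, hk]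
    exact add_le_add_left h _
  have hpos : IsStrictlyPositive (cfc f X) := by
    rw [cfc_isStrictlyPositive_iff _ _ (continuousOn_spectrum X _) hXs]
    intro x hx
    have := spectrum_nonneg hX hx
    by_cases h : x = 0
    · simp [hf, h, hc]
    · simpa [hf, h] using this.lt_of_ne' h
  have h4 := CFC.rpow_le_rpow ⟨hp.le, hp1⟩ (CStarAlgebra.rpow_neg_one_le_rpow_neg_one h3 hpos)
  have h0X := hpos.nonneg
  have h0Y := h0X.trans h3
  have key : ∀ {Z : Matrix n n ℂ}, 0 ≤ Z → (Z ^ (-1 : ℝ)) ^ p = cfc (fun x : ℝ => x ^ (-p)) Z := by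
    intro Z hZ
    have hZ' : 0 ≤ Z ^ (-1 : ℝ) := by simp
    rw [CFC.rpow_eq_cfc_real hZ', CFC.rpow_eq_cfc_real hZ, cfc_comp_matrix _ _ hZ]
    refine cfc_congr fun x hx => ?_
    rw [← Real.rpow_mul (spectrum_nonneg hZ hx)]
    ring_nf
  rw [key h0X, key h0Y, cfc_comp_matrix _ _ hX, cfc_comp_matrix _ _ hY] at h4
  have hP : suppPow X 0 = suppPow Y 0 := by
    rw [eq_sub_of_add_eq (suppPow_zero_add_kerProj hX), hk,
      eq_sub_of_add_eq (suppPow_zero_add_kerProj hY)]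
  have h5 := conj_le_conj h4 (suppPow X 0)
  rw [show (suppPow X 0)ᴴ = suppPow X 0 from IsSelfAdjoint.of_nonneg (suppPow_nonneg hX 0)] at h5
  have h6 : suppPow X 0 * cfc (fun x => f x ^ (-p)) X * suppPow X 0 = suppPow X (-p) := by
    rw [suppPow, suppPow, ← cfc_mul_matrix, ← cfc_mul_matrix]
    refine cfc_congr fun x _ => ?_
    by_cases h : x = 0 <;> simp [hf, h]
  have h7 : suppPow X 0 * cfc (fun x => g x ^ (-p)) Y * suppPow X 0 =
      c ^ (-p) • suppPow Y (-p) := by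
    rw [hP, suppPow, suppPow, ← cfc_mul_matrix, ← cfc_mul_matrix,
      ← cfc_smul _ _ _ (continuousOn_spectrum Y _)]
    refine cfc_congr fun x hx => ?_
    by_cases h : x = 0
    · simp [hg, h]
    · simp [hg, h, Real.mul_rpow hc.le (spectrum_nonneg hY hx)]
  rw [h6, h7] at h5
  have h8 := smul_le_smul_of_nonneg_left h5 (Real.rpow_nonneg hc.le p)
  rwa [smul_smul, ← Real.rpow_add hc, add_neg_cancel, Real.rpow_zero, one_smul] at h8

end LoewnerHeinz

/-! ### Hilbert's projective metric on positive semidefinite matrices -/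

section HilbertMetric

variable {n m : Type*} [Fintype n] [DecidableEq n] [Fintype m] [DecidableEq m]
  {X Y : Matrix n n ℂ}

/-- `X` and `Y` dominate each other with constants whose product is at most `exp d`, i.e.
Hilbert's projective distance of `X` and `Y` is at most `d`. -/
def HilbertLE (X Y : Matrix n n ℂ) (d : ℝ) : Prop :=
  ∃ s t : ℝ, 0 < s ∧ 0 < t ∧ X ≤ s • Y ∧ Y ≤ t • X ∧ s * t ≤ Real.exp d

lemma HilbertLE.dom {d : ℝ} (h : HilbertLE X Y d) : Dom X Y ∧ Dom Y X := by
  obtain ⟨s, t, hs, ht, h1, h2, -⟩ := h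
  exact ⟨⟨s, hs.le, h1⟩, ⟨t, ht.le, h2⟩⟩

lemma HilbertLE.suppPow_neg {d p : ℝ} (hp : 0 < p) (hp1 : p ≤ 1) (hX : 0 ≤ X) (hY : 0 ≤ Y)
    (h : HilbertLE X Y d) : HilbertLE (suppPow X (-p)) (suppPow Y (-p)) (p * d) := by
  have hk := kerProj_eq_of_dom hX hY h.dom.1 h.dom.2
  obtain ⟨s, t, hs, ht, h1, h2, h3⟩ := h
  refine ⟨t ^ p, s ^ p, Real.rpow_pos_of_pos ht p, Real.rpow_pos_of_pos hs p,
    suppPow_neg_le_suppPow_neg hp hp1 ht hY hX h2 hk.symm,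
    suppPow_neg_le_suppPow_neg hp hp1 hs hX hY h1 hk, ?_⟩
  rw [← Real.mul_rpow ht.le hs.le, mul_comm p, Real.exp_mul, mul_comm t]
  exact Real.rpow_le_rpow (by positivity) h3 hp.le

lemma HilbertLE.suppPow {d q : ℝ} (hq : 0 < q) (hq1 : q ≤ 1) (hX : 0 ≤ X) (hY : 0 ≤ Y)
    (h : HilbertLE X Y d) : HilbertLE (suppPow X q) (suppPow Y q) (q * d) := by
  obtain ⟨s, t, hs, ht, h1, h2, h3⟩ := h
  refine ⟨s ^ q, t ^ q, Real.rpow_pos_of_pos hs q, Real.rpow_pos_of_pos ht q, ?_, ?_, ?_⟩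
  · rw [← suppPow_smul hs hY]
    exact suppPow_le_suppPow hq hq1 hX h1
  · rw [← suppPow_smul ht hX]
    exact suppPow_le_suppPow hq hq1 hY h2
  · rw [← Real.mul_rpow hs.le ht.le, mul_comm q, Real.exp_mul]
    exact Real.rpow_le_rpow (by positivity) h3 hq.le

lemma HilbertLE.smul {d a b : ℝ} (ha : 0 < a) (hb : 0 < b) (h : HilbertLE X Y d) :
    HilbertLE (a • X) (b • Y) d := by
  obtain ⟨s, t, hs, ht, h1, h2, h3⟩ := h
  refine ⟨a * s / b, b * t / a, by positivity, by positivity, ?_, ?_, ?_⟩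
  · rw [smul_smul, div_mul_cancel₀ _ hb.ne', mul_smul]
    exact smul_le_smul_of_nonneg_left h1 ha.le
  · rw [smul_smul, div_mul_cancel₀ _ ha.ne', mul_smul]
    exact smul_le_smul_of_nonneg_left h2 hb.le
  · rw [show a * s / b * (b * t / a) = s * t by field_simp]
    exact h3

lemma trace_re_le (h : X ≤ Y) : X.trace.re ≤ Y.trace.re := by
  have := (Matrix.le_iff.1 h).trace_nonneg
  rw [trace_sub, sub_nonneg] at this
  exact (Complex.le_def.1 this).1

/-- For matrices of trace one, the normalization of the two constants is fixed. -/
lemma HilbertLE.le_exp_smul {d : ℝ} (hX : 0 ≤ X) (hX1 : X.trace = 1) (hY1 : Y.trace = 1)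
    (h : HilbertLE X Y d) : Y ≤ Real.exp d • X := by
  obtain ⟨s, t, hs, ht, h1, h2, h3⟩ := h
  have h4 := trace_re_le h1
  rw [trace_smul, hX1, hY1] at h4
  have h5 : 1 ≤ s := by simpa using h4
  refine h2.trans (smul_le_smul_of_nonneg_right (le_trans ?_ h3) hX)
  nlinarith

lemma isClosed_setOf_le (X Y : Matrix n n ℂ) : IsClosed {t : ℝ | X ≤ t • Y} := by
  have : IsClosed {Z : Matrix n n ℂ | 0 ≤ Z} := by
    have h : {Z : Matrix n n ℂ | 0 ≤ Z} = {Z : Matrix n n ℂ | Zᴴ = Z} ∩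
        ⋂ x : n → ℂ, {Z : Matrix n n ℂ | 0 ≤ star x ⬝ᵥ (Z *ᵥ x)} := by
      ext Z
      simp [nonneg_iff_posSemidef, posSemidef_iff_dotProduct_mulVec, IsHermitian]
    rw [h]
    refine (isClosed_eq (by fun_prop) continuous_id).inter (isClosed_iInter fun x => ?_)
    exact isClosed_le continuous_const (by fun_prop)
  have h2 : {t : ℝ | X ≤ t • Y} = (fun t : ℝ => t • Y - X) ⁻¹' {Z : Matrix n n ℂ | 0 ≤ Z} := by
    ext t; simp
  rw [h2]
  exact this.preimage (by fun_prop)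

lemma trace_re_pos (hX : 0 ≤ X) (h0 : X ≠ 0) : 0 < X.trace.re := by
  have h1 := (nonneg_iff_posSemidef.1 hX)
  have h2 := Complex.le_def.1 h1.trace_nonneg
  refine lt_of_le_of_ne h2.1 fun h3 => h0 (h1.trace_eq_zero_iff.1 ?_)
  exact Complex.ext h3.symm h2.2.symm

lemma nonneg_of_le_smul (hX : 0 ≤ X) (hY : 0 ≤ Y) (h0 : Y ≠ 0) {t : ℝ} (h : X ≤ t • Y) :
    0 ≤ t := by
  have h1 := trace_re_le (hX.trans h)
  rw [trace_smul] at h1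
  have h2 := trace_re_pos hY h0
  by_contra! h3
  simp at h1
  nlinarith

/-- The infimum `M(X/Y)` is attained. -/
lemma le_coneM_smul (hX : 0 ≤ X) (hY : 0 ≤ Y) (h0 : Y ≠ 0) (h : Dom X Y) :
    X ≤ coneM (psdCone n) X Y • Y := by
  obtain ⟨t, -, ht⟩ := h
  exact (isClosed_setOf_le X Y).csInf_mem ⟨t, ht⟩
    ⟨0, fun s hs => nonneg_of_le_smul hX hY h0 hs⟩

lemma coneM_le (hX : 0 ≤ X) (hY : 0 ≤ Y) (h0 : Y ≠ 0) {t : ℝ} (h : X ≤ t • Y) :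
    coneM (psdCone n) X Y ≤ t :=
  csInf_le ⟨0, fun _ hs => nonneg_of_le_smul hX hY h0 hs⟩ h

lemma coneM_pos (hX : 0 ≤ X) (hX0 : X ≠ 0) (hY : 0 ≤ Y) (h0 : Y ≠ 0) (h : Dom X Y) :
    0 < coneM (psdCone n) X Y := by
  have h1 := le_coneM_smul hX hY h0 h
  refine lt_of_le_of_ne (nonneg_of_le_smul hX hY h0 h1) fun h2 => hX0 ?_
  rw [← h2, zero_smul] at h1
  exact le_antisymm h1 hX

lemma one_le_mul_of_le (hX : 0 ≤ X) (hX0 : X ≠ 0) {s t : ℝ} (hs : 0 ≤ s) (h : X ≤ s • Y)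
    (h' : Y ≤ t • X) : 1 ≤ s * t := by
  have h1 := h.trans (smul_le_smul_of_nonneg_left h' hs)
  rw [smul_smul] at h1
  have h2 := trace_re_le h1
  have h3 := trace_re_pos hX hX0
  rw [trace_smul] at h2
  simp at h2
  nlinarith

/-- Between mutually dominating nonzero matrices, Hilbert's metric is finite, and the constants
realizing it are attained. -/
lemma exists_dH_eq (hX : 0 ≤ X) (hX0 : X ≠ 0) (hY : 0 ≤ Y) (hY0 : Y ≠ 0) (h : Dom X Y)
    (h' : Dom Y X) : ∃ d : ℝ, 0 ≤ d ∧ dH X Y = (d : EReal) ∧ HilbertLE X Y d := by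
  have h1 := le_coneM_smul hX hY hY0 h
  have h2 := le_coneM_smul hY hX hX0 h'
  have h3 := coneM_pos hX hX0 hY hY0 h
  have h4 := coneM_pos hY hY0 hX hX0 h'
  have h5 := one_le_mul_of_le hX hX0 h3.le h1 h2
  refine ⟨_, Real.log_nonneg h5, ?_, _, _, h3, h4, h1, h2, (Real.exp_log (by positivity)).ge⟩
  rw [dH, hilbertMetric, if_pos]
  refine ⟨⟨⟨0, _, ?_, h1⟩, ⟨0, _, ?_, h2⟩⟩, hY0⟩
  · simpa [ConeLE, psdCone] using nonneg_iff_posSemidef.1 hX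
  · simpa [ConeLE, psdCone] using nonneg_iff_posSemidef.1 hY

end HilbertMetric

/-! ### Partial traces and marginals -/

section Bipartite

variable {a b : Type*} [Fintype a] [DecidableEq a] [Fintype b] [DecidableEq b]
  {Z : Matrix (a × b) (a × b) ℂ} {X : Matrix a a ℂ} {T : Matrix b b ℂ}

lemma exists_eq_sum_rankOne (hX : 0 ≤ X) :
    ∃ (d : a → ℝ) (v : a → EuclideanSpace ℂ a), (∀ i, 0 ≤ d i) ∧ (∀ i, ‖v i‖ = 1) ∧
      X = ∑ i, d i • vecMulVec (v i).ofLp (star (v i).ofLp) := by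
  have h := nonneg_iff_posSemidef.1 hX
  refine ⟨h.1.eigenvalues, h.1.eigenvectorBasis, h.eigenvalues_nonneg,
    h.1.eigenvectorBasis.norm_eq_one, ?_⟩
  conv_lhs => rw [h.1.spectral_theorem, Unitary.conjStarAlgAut_apply]
  ext i j
  simp only [Matrix.mul_apply, diagonal_apply, Matrix.sum_apply, vecMulVec_apply,
    Matrix.star_apply, Matrix.smul_apply, mul_ite, mul_zero, Finset.sum_ite_eq', Finset.mem_univ,
    if_true, IsHermitian.eigenvectorUnitary_apply, Pi.star_apply, Complex.real_smul]
  exact Finset.sum_congr rfl fun k _ => by simp; ring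

/-- The map `X ↦ tr_A[Z (X ⊗ 1)]` from operators on `A` to operators on `B`, as a real linear map:
only real multiples preserve the order. -/
def partialMap (Z : Matrix (a × b) (a × b) ℂ) : Matrix a a ℂ →ₗ[ℝ] Matrix b b ℂ where
  toFun X := trA (Z * X ⊗ₖ (1 : Matrix b b ℂ))
  map_add' X Y := by
    ext; simp [trA, add_kronecker, Matrix.mul_add, Finset.sum_add_distrib]
  map_smul' c X := by
    ext; simp [trA, smul_kronecker, Finset.mul_sum]

lemma partialMap_apply (j j' : b) :
    partialMap Z X j j' = ∑ i, ∑ k, Z (i, j) (k, j') * X k i := by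
  change trA (Z * X ⊗ₖ (1 : Matrix b b ℂ)) j j' = _
  simp [trA, Matrix.mul_apply, Fintype.sum_prod_type, Matrix.one_apply]

lemma partialMap_one : partialMap Z 1 = trA Z := by
  change trA (Z * (1 : Matrix a a ℂ) ⊗ₖ (1 : Matrix b b ℂ)) = _
  rw [one_kronecker_one, Matrix.mul_one]

lemma partialMap_sub_left (W : Matrix (a × b) (a × b) ℂ) :
    partialMap (Z - W) X = partialMap Z X - partialMap W X := by
  ext; simp [partialMap_apply, sub_mul]

lemma partialMap_smul_left (c : ℝ) : partialMap (c • Z) X = c • partialMap Z X := by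
  ext; simp [partialMap_apply, Finset.mul_sum, mul_assoc]

lemma partialMap_rankOne (φ : EuclideanSpace ℂ a) :
    partialMap Z (vecMulVec φ.ofLp (star φ.ofLp)) = sandwich Z φ := by
  ext j j'
  simp only [partialMap_apply, sandwich, vecMulVec_apply, of_apply, Pi.star_apply]
  exact Finset.sum_congr rfl fun i _ => Finset.sum_congr rfl fun k _ => by ring

/-- `⟨φ|Z|φ⟩ = Vᴴ Z V` for the operator `V = φ ⊗ 1` from `B` to `A ⊗ B`. -/
lemma sandwich_eq (Z : Matrix (a × b) (a × b) ℂ) (φ : EuclideanSpace ℂ a) :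
    sandwich Z φ = (Matrix.of fun (x : a × b) (j : b) => φ x.1 * (1 : Matrix b b ℂ) x.2 j)ᴴ * Z *
      (Matrix.of fun (x : a × b) (j : b) => φ x.1 * (1 : Matrix b b ℂ) x.2 j) := by
  ext j j'
  simp only [sandwich, of_apply, Matrix.mul_apply, conjTranspose_apply, Fintype.sum_prod_type,
    Matrix.one_apply, star_mul']
  simp only [mul_ite, mul_one, mul_zero, apply_ite star, star_one, star_zero, ite_mul, zero_mul,
    Finset.sum_ite_eq', Finset.mem_univ, if_true, Finset.sum_mul]
  exact Finset.sum_comm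

lemma sandwich_nonneg (hZ : 0 ≤ Z) (φ : EuclideanSpace ℂ a) : 0 ≤ sandwich Z φ := by
  rw [sandwich_eq]
  exact nonneg_iff_posSemidef.2 ((nonneg_iff_posSemidef.1 hZ).conjTranspose_mul_mul_same _)

lemma partialMap_nonneg (hZ : 0 ≤ Z) (hX : 0 ≤ X) : 0 ≤ partialMap Z X := by
  obtain ⟨d, v, hd, -, rfl⟩ := exists_eq_sum_rankOne hX
  rw [map_sum]
  refine Finset.sum_nonneg fun i _ => ?_
  rw [map_smul, partialMap_rankOne]
  exact smul_nonneg (hd i) (sandwich_nonneg hZ _)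

lemma partialMap_mono (hZ : 0 ≤ Z) {X Y : Matrix a a ℂ} (h : X ≤ Y) :
    partialMap Z X ≤ partialMap Z Y := by
  rw [← sub_nonneg, ← map_sub]
  exact partialMap_nonneg hZ (sub_nonneg.2 h)

lemma partialMap_mono_left {W : Matrix (a × b) (a × b) ℂ} (h : Z ≤ W) (hX : 0 ≤ X) :
    partialMap Z X ≤ partialMap W X := by
  rw [← sub_nonneg, ← partialMap_sub_left]
  exact partialMap_nonneg (sub_nonneg.2 h) hX

lemma trace_partialMap_mul : (partialMap Z X * T).trace = (Z * X ⊗ₖ T).trace := by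
  simp only [trace, diag_apply, Matrix.mul_apply, partialMap_apply, Fintype.sum_prod_type,
    kronecker_apply, Finset.sum_mul]
  rw [Finset.sum_comm (s := (Finset.univ : Finset a))]
  refine Finset.sum_congr rfl fun j _ => ?_
  rw [Finset.sum_comm]
  refine Finset.sum_congr rfl fun i _ => ?_
  rw [Finset.sum_comm]
  exact Finset.sum_congr rfl fun k _ => Finset.sum_congr rfl fun j' _ => by ring

/-- The operator on `B ⊗ A` obtained by exchanging the two systems. -/
def swapSys (Z : Matrix (a × b) (a × b) ℂ) : Matrix (b × a) (b × a) ℂ :=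
  Z.submatrix (Equiv.prodComm b a) (Equiv.prodComm b a)

lemma swapSys_nonneg (hZ : 0 ≤ Z) : 0 ≤ swapSys Z :=
  nonneg_iff_posSemidef.2 ((nonneg_iff_posSemidef.1 hZ).submatrix _)

lemma trA_swapSys : trA (swapSys Z) = trB Z := rfl
lemma trB_swapSys : trB (swapSys Z) = trA Z := rfl

lemma suppPow_swapSys (hZ : 0 ≤ Z) (p : ℝ) : suppPow (swapSys Z) p = swapSys (suppPow Z p) :=
  suppPow_submatrix _ (IsSelfAdjoint.of_nonneg hZ) p

lemma swapSys_mul (W : Matrix (a × b) (a × b) ℂ) : swapSys (Z * W) = swapSys Z * swapSys W :=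
  (submatrix_mul_equiv Z W _ (Equiv.prodComm b a) _).symm

lemma swapSys_kronecker : swapSys (X ⊗ₖ T) = T ⊗ₖ X := by
  ext i j; simp [swapSys, mul_comm]

lemma trace_swapSys : (swapSys Z).trace = Z.trace :=
  (Equiv.prodComm b a).sum_comp fun i => Z i i

lemma trace_partialMap_swapSys_mul :
    (partialMap (swapSys Z) T * X).trace = (partialMap Z X * T).trace := by
  rw [trace_partialMap_mul, trace_partialMap_mul, ← swapSys_kronecker, ← swapSys_mul,
    trace_swapSys]

lemma preAB_eq (α : ℝ) (ρ : Matrix (a × b) (a × b) ℂ) (σ : Matrix a a ℂ) :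
    preAB α ρ σ = suppPow (partialMap (suppPow ρ α) (suppPow σ (1 - α))) (1 / α) := rfl

lemma preBA_eq (α : ℝ) {ρ : Matrix (a × b) (a × b) ℂ} (hρ : 0 ≤ ρ) (τ : Matrix b b ℂ) :
    preBA α ρ τ = preAB α (swapSys ρ) τ := by
  rw [preAB_eq, suppPow_swapSys hρ, preBA]
  congr 1
  change _ = trA (swapSys (suppPow ρ α) * suppPow τ (1 - α) ⊗ₖ (1 : Matrix a a ℂ))
  rw [← swapSys_kronecker, ← swapSys_mul, trA_swapSys]
  rfl

lemma stepBA_eq (α : ℝ) {ρ : Matrix (a × b) (a × b) ℂ} (hρ : 0 ≤ ρ) (τ : Matrix b b ℂ) :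
    stepBA α ρ τ = stepAB α (swapSys ρ) τ := by
  rw [stepBA, stepAB, preBA_eq α hρ]

lemma trA_kronecker : trA (X ⊗ₖ T) = X.trace • T := by
  ext; simp [trA, trace, Finset.sum_mul]

lemma trA_mono {W : Matrix (a × b) (a × b) ℂ} (h : Z ≤ W) : trA Z ≤ trA W := by
  rw [← partialMap_one, ← partialMap_one]
  exact partialMap_mono_left h zero_le_one

lemma trA_nonneg (hZ : 0 ≤ Z) : 0 ≤ trA Z := by
  rw [← partialMap_one]
  exact partialMap_nonneg hZ zero_le_one

lemma trA_smul (c : ℝ) : trA (c • Z) = c • trA Z := by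
  rw [← partialMap_one, ← partialMap_one, partialMap_smul_left]

lemma trace_trA : (trA Z).trace = Z.trace := by
  have := trace_partialMap_mul (Z := Z) (X := 1) (T := 1)
  rwa [partialMap_one, one_kronecker_one, Matrix.mul_one, Matrix.mul_one] at this

lemma dom_trA_of_dom (hX : 0 ≤ X) (h : Dom Z (X ⊗ₖ T)) : Dom (trA Z) T := by
  obtain ⟨t, ht, h⟩ := h
  have h1 := trA_mono h
  rw [trA_smul, trA_kronecker] at h1
  have h2 := Complex.le_def.1 (nonneg_iff_posSemidef.1 hX).trace_nonneg
  rw [show X.trace = ((X.trace.re : ℝ) : ℂ) from Complex.ext rfl (by simpa using h2.2.symm)] at h1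
  refine ⟨t * X.trace.re, mul_nonneg ht h2.1, h1.trans_eq ?_⟩
  rw [mul_smul]; rfl

lemma swapSys_mono {W : Matrix (a × b) (a × b) ℂ} (h : Z ≤ W) : swapSys Z ≤ swapSys W :=
  sub_nonneg.1 (swapSys_nonneg (sub_nonneg.2 h))

lemma dom_swapSys {W : Matrix (a × b) (a × b) ℂ} (h : Dom Z W) : Dom (swapSys Z) (swapSys W) := by
  obtain ⟨t, ht, h⟩ := h
  exact ⟨t, ht, swapSys_mono h⟩

/-- An operator vanishes on the kernel of anything that dominates its marginal, because
`tr[Z (1 ⊗ P)] = tr[(tr_A Z) P]`. -/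
lemma mul_kronecker_kerProj (hZ : 0 ≤ Z) (hT : 0 ≤ T) (h : Dom (trA Z) T) :
    Z * (1 : Matrix a a ℂ) ⊗ₖ kerProj T = 0 := by
  set P := (1 : Matrix a a ℂ) ⊗ₖ kerProj T with hP
  have hPs : Pᴴ = P := by
    rw [hP, conjTranspose_kronecker, conjTranspose_one, kerProj_isSelfAdjoint]
  refine mul_eq_zero_of_conj_eq_zero hZ ?_
  have h1 : (Pᴴ * Z * P).PosSemidef := (nonneg_iff_posSemidef.1 hZ).conjTranspose_mul_mul_same P
  rw [← h1.trace_eq_zero_iff, hPs, Matrix.mul_assoc, trace_mul_comm, Matrix.mul_assoc]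
  rw [hP, ← mul_kronecker_mul, kerProj_mul_self, Matrix.mul_one, ← trace_partialMap_mul,
    partialMap_one, h.mul_kerProj (trA_nonneg hZ) hT, trace_zero]

lemma mul_kerProj_kronecker (hZ : 0 ≤ Z) (hX : 0 ≤ X) (h : Dom (trB Z) X) :
    Z * kerProj X ⊗ₖ (1 : Matrix b b ℂ) = 0 := by
  have := congrArg swapSys
    (mul_kronecker_kerProj (swapSys_nonneg hZ) hX (by rwa [trA_swapSys]))
  rwa [swapSys_mul, swapSys_kronecker] at this

/-- The support of a bipartite operator lies in `supp σ ⊗ supp τ` exactly when the supports of its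
marginals lie in `supp σ` and `supp τ`. -/
lemma dom_kronecker_iff (hZ : 0 ≤ Z) (hX : 0 ≤ X) (hT : 0 ≤ T) :
    Dom Z (X ⊗ₖ T) ↔ Dom (trB Z) X ∧ Dom (trA Z) T := by
  constructor
  · intro h
    refine ⟨?_, dom_trA_of_dom hX h⟩
    have := dom_swapSys h
    rw [swapSys_kronecker] at this
    rw [← trA_swapSys]
    exact dom_trA_of_dom hT this
  · rintro ⟨h1, h2⟩
    have hXT : 0 ≤ X ⊗ₖ T := nonneg_iff_posSemidef.2
      ((nonneg_iff_posSemidef.1 hX).kronecker (nonneg_iff_posSemidef.1 hT))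
    refine dom_of_mul_kerProj hZ hXT ?_
    have h3 := mul_kronecker_kerProj hZ hT h2
    have h4 : Z * kerProj X ⊗ₖ (1 : Matrix b b ℂ) = 0 := by
      have := congrArg swapSys 
        (mul_kronecker_kerProj (swapSys_nonneg hZ) hX (by rwa [trA_swapSys]))
      rwa [swapSys_mul, swapSys_kronecker] at this
    have h5 : Z = Z * suppPow X 0 ⊗ₖ (1 : Matrix b b ℂ) := by
      have := congrArg (fun W => Z * W ⊗ₖ (1 : Matrix b b ℂ)) (suppPow_zero_add_kerProj hX)
      simpa [add_kronecker, Matrix.mul_add, h4] using this.symm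
    have h6 : Z = Z * (1 : Matrix a a ℂ) ⊗ₖ suppPow T 0 := by
      have := congrArg (fun W => Z * (1 : Matrix a a ℂ) ⊗ₖ W) (suppPow_zero_add_kerProj hT)
      simpa [kronecker_add, Matrix.mul_add, h3] using this.symm
    rw [eq_sub_of_add_eq' (suppPow_zero_add_kerProj hXT), suppPow_kronecker hX hT,
      Matrix.mul_sub, Matrix.mul_one, sub_eq_zero]
    calc Z = Z * suppPow X 0 ⊗ₖ (1 : Matrix b b ℂ) := h5
      _ = Z * (1 : Matrix a a ℂ) ⊗ₖ suppPow T 0 * suppPow X 0 ⊗ₖ (1 : Matrix b b ℂ) := by rw [← h6]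
      _ = _ := by rw [Matrix.mul_assoc, ← mul_kronecker_mul, Matrix.one_mul, Matrix.mul_one]

end Bipartite

/-! ### The equality case of the reverse Hölder inequality -/

section TraceInequality

variable {n : Type*} [Fintype n] [DecidableEq n] {X Y : Matrix n n ℂ}

/-- In eigenbases of `X` and `Y`, with eigenvalues `x i` and `y j`, the weights are the squared
absolute values of the inner products of eigenvectors. -/
lemma exists_trace_cfc_mul_cfc (hX : 0 ≤ X) (hY : 0 ≤ Y) :
    ∃ (x y : n → ℝ) (w : n → n → ℝ), (∀ i, 0 ≤ x i) ∧ (∀ j, 0 ≤ y j) ∧ (∀ i j, 0 ≤ w i j) ∧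
      ∀ f g : ℝ → ℝ, (cfc f X * cfc g Y).trace.re = ∑ i, ∑ j, w i j * (f (x i) * g (y j)) := by
  obtain ⟨U, d, hd, hXU⟩ := eq_conj_diagonal (IsSelfAdjoint.of_nonneg hX)
  obtain ⟨V, e, he, hYV⟩ := eq_conj_diagonal (IsSelfAdjoint.of_nonneg hY)
  set W : Matrix n n ℂ := star (U : Matrix n n ℂ) * (V : Matrix n n ℂ) with hW
  refine ⟨d, e, fun i j => Complex.normSq (W i j), fun i => spectrum_nonneg hX (hd i),
    fun j => spectrum_nonneg hY (he j), fun i j => Complex.normSq_nonneg _, fun f g => ?_⟩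
  have hWs : star (V : Matrix n n ℂ) * (U : Matrix n n ℂ) = Wᴴ := by
    rw [hW, ← star_eq_conjTranspose, star_mul, star_star]
  have h1 : (cfc f X * cfc g Y).trace =
      (diagonal (fun i => (f (d i) : ℂ)) * W * diagonal (fun i => (g (e i) : ℂ)) * Wᴴ).trace := by
    conv_lhs => rw [hXU, hYV]
    rw [cfc_conj_diagonal, cfc_conj_diagonal, hW, ← hWs]
    simp only [Matrix.mul_assoc]
    rw [trace_mul_comm]
    simp only [Matrix.mul_assoc]
  rw [h1]
  simp only [trace, diag_apply, Matrix.mul_apply, diagonal_apply, ite_mul, zero_mul, mul_ite,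
    mul_zero, Finset.sum_ite_eq, Finset.sum_ite_eq', Finset.mem_univ, if_true,
    conjTranspose_apply, Complex.re_sum]
  refine Finset.sum_congr rfl fun i _ => Finset.sum_congr rfl fun j _ => ?_
  have : (f (d i) : ℂ) * W i j * (g (e j) : ℂ) * star (W i j) =
      ((Complex.normSq (W i j) * (f (d i) * g (e j)) : ℝ) : ℂ) := by
    rw [Complex.star_def]
    push_cast
    rw [Complex.normSq_eq_conj_mul_self]
    ring
  rw [this, Complex.ofReal_re]

/-- The tangent to `z ^ α t ^ (1 - α)` along `z = t` lies below it, strictly away from `z = t`. -/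
lemma rpow_mul_rpow_ge {α z t : ℝ} (hα : 1 < α) (hz : 0 ≤ z) (ht : 0 < t) :
    α * z - (α - 1) * t ≤ z ^ α * t ^ (1 - α) ∧
      (z ^ α * t ^ (1 - α) = α * z - (α - 1) * t → z = t) := by
  have h0 : z ^ α * t ^ (1 - α) = t * (z / t) ^ α := by
    rw [Real.div_rpow hz ht.le, Real.rpow_sub ht, Real.rpow_one]; ring
  have h1 : α * z - (α - 1) * t = t * (1 + α * (z / t - 1)) := by field_simp; ring
  have h2 : -1 ≤ z / t - 1 := by
    have : 0 ≤ z / t := by positivity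
    linarith
  by_cases h3 : z / t - 1 = 0
  · have h4 : z / t = 1 := by linarith
    have : z = t := by rwa [div_eq_one_iff_eq ht.ne'] at h4
    rw [h0, h1, h4]
    simp [this]
  · have h5 := one_add_mul_self_lt_rpow_one_add h2 h3 hα
    rw [add_sub_cancel] at h5
    rw [h0, h1]
    have h6 := mul_lt_mul_of_pos_left h5 ht
    exact ⟨h6.le, fun h7 => absurd h7 h6.ne'⟩

/-- The reverse Hölder inequality is an equality at the normalization of `X ^ (1 / α)`. -/
lemma trace_mul_suppPow_eq {α : ℝ} (hα : 1 < α) (hX : 0 ≤ X) {k : ℝ} (hk : 0 < k)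
    (hkX : (suppPow X (1 / α)).trace.re = k) :
    (X * suppPow (k⁻¹ • suppPow X (1 / α)) (1 - α)).trace.re = k ^ α := by
  have hα0 : α ≠ 0 := by linarith
  rw [suppPow_smul (inv_pos.2 hk) (suppPow_nonneg hX _), suppPow_suppPow hX]
  conv_lhs => enter [1, 1, 1]; rw [← suppPow_one hX]
  rw [Matrix.mul_smul, suppPow_mul_suppPow hX,
    show 1 + 1 / α * (1 - α) = 1 / α by field_simp; ring, trace_smul]
  rw [Complex.smul_re, hkX, smul_eq_mul, Real.inv_rpow hk.le, ← Real.rpow_neg hk.le]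
  nth_rewrite 2 [← Real.rpow_one k]
  rw [← Real.rpow_add hk]
  ring_nf

/-- The equality case of the reverse Hölder inequality
`tr[X Y ^ (1 - α)] ≥ (tr X ^ (1 / α)) ^ α` for a state `Y`. -/
lemma eq_of_trace_mul_suppPow_le {α : ℝ} (hα : 1 < α) (hX : 0 ≤ X) (hY : 0 ≤ Y)
    (hY1 : Y.trace = 1) (hdom : Dom X Y) {k : ℝ} (hk : 0 < k)
    (hkX : (suppPow X (1 / α)).trace.re = k)
    (hle : (X * suppPow Y (1 - α)).trace.re ≤ k ^ α) : Y = k⁻¹ • suppPow X (1 / α) := by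
  have hα0 : 0 < α := by linarith
  have hsX := IsSelfAdjoint.of_nonneg hX
  have hsY := IsSelfAdjoint.of_nonneg hY
  obtain ⟨x, y, w, hx, hy, hw, htr⟩ := exists_trace_cfc_mul_cfc hX hY
  set Z : Matrix n n ℂ := k⁻¹ • suppPow X (1 / α) with hZ
  set z : ℝ → ℝ := fun x => k⁻¹ * (if x = 0 then 0 else x ^ (1 / α)) with hz
  set g : ℝ → ℝ := fun t => if t = 0 then 0 else t ^ (1 - α) with hg
  have hZc : Z = cfc z X := by
    rw [hZ, suppPow, ← cfc_smul _ _ _ (continuousOn_spectrum X _)]; rfl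
  have hXc : cfc (fun x : ℝ => x) X = X := cfc_id' ℝ X hsX
  have hYc : cfc (fun x : ℝ => x) Y = Y := cfc_id' ℝ Y hsY
  have hX1 : cfc (fun _ : ℝ => (1 : ℝ)) X = 1 := cfc_const_one ℝ X hsX
  have hY1' : cfc (fun _ : ℝ => (1 : ℝ)) Y = 1 := cfc_const_one ℝ Y hsY
  have hZ1 : Z.trace.re = 1 := by
    rw [hZ, trace_smul, Complex.smul_re, hkX, smul_eq_mul, inv_mul_cancel₀ hk.ne']
  -- Domination of `X` by `Y` rules out the terms where `0 ^ (1 - α)` takes its conventional value.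
  have hker : ∀ i j, w i j ≠ 0 → y j = 0 → x i = 0 := by
    intro i j hwij hyj
    have h1 := htr (fun x => x) (fun x => if x = 0 then 1 else 0)
    rw [hXc, show cfc (fun x : ℝ => if x = 0 then (1 : ℝ) else 0) Y = kerProj Y from rfl,
      hdom.mul_kerProj hX hY, trace_zero, Complex.zero_re, eq_comm,
      Finset.sum_eq_zero_iff_of_nonneg] at h1
    · have h2 := h1 i (Finset.mem_univ _)
      rw [Finset.sum_eq_zero_iff_of_nonneg] at h2
      · have h3 := h2 j (Finset.mem_univ _)
        simpa [hyj, hwij] using h3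
      · intro j _
        have := hw i j; have := hx i
        split_ifs <;> positivity
    · intro i _
      refine Finset.sum_nonneg fun j _ => ?_
      have := hw i j; have := hx i
      split_ifs <;> positivity
  have hz0 : ∀ i, 0 ≤ z (x i) := by
    intro i
    have := hx i
    simp only [hz]
    split_ifs <;> positivity
  have hzx : ∀ i, x i = k ^ α * z (x i) ^ α := by
    intro i
    by_cases h : x i = 0
    · simp [hz, h, hα0.ne']
    · simp only [hz, h, if_false]
      have := hx i
      rw [← Real.mul_rpow hk.le (by positivity), mul_inv_cancel_left₀ hk.ne', ← Real.rpow_mul this,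
        one_div_mul_cancel hα0.ne', Real.rpow_one]
  have hterm : ∀ i j, w i j ≠ 0 →
      k ^ α * (α * z (x i) - (α - 1) * y j) ≤ x i * g (y j) ∧
      (x i * g (y j) = k ^ α * (α * z (x i) - (α - 1) * y j) → z (x i) = y j) := by
    intro i j hwij
    have hkα : 0 < k ^ α := Real.rpow_pos_of_pos hk α
    by_cases h : y j = 0
    · have h0 := hker i j hwij h
      simp [h, h0, hz]
    · have h1 := rpow_mul_rpow_ge hα (hz0 i) ((hy j).lt_of_ne' h)
      have h2 : x i * g (y j) = k ^ α * (z (x i) ^ α * y j ^ (1 - α)) := by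
        conv_lhs => rw [hzx i]
        simp only [hg, h, if_false]
        ring
      rw [h2]
      exact ⟨mul_le_mul_of_nonneg_left h1.1 hkα.le,
        fun h3 => h1.2 (mul_left_cancel₀ hkα.ne' h3)⟩
  -- The summands `q i j` are nonnegative, and their sum is the excess in the Hölder inequality.
  set q : n → n → ℝ := fun i j =>
    w i j * (x i * g (y j) - k ^ α * (α * z (x i) - (α - 1) * y j)) with hq
  have hq0 : ∀ i j, 0 ≤ q i j := by
    intro i j
    by_cases h : w i j = 0
    · simp [hq, h]
    · exact mul_nonneg (hw i j) (sub_nonneg.2 (hterm i j h).1)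
  have hsum : ∑ i, ∑ j, q i j = (X * suppPow Y (1 - α)).trace.re - k ^ α := by
    have h1 := htr (fun x => x) g
    have h2 := htr z (fun _ => 1)
    have h3 := htr (fun _ => 1) (fun x => x)
    rw [hXc] at h1
    rw [hY1', ← hZc, Matrix.mul_one, hZ1] at h2
    rw [hX1, hYc, Matrix.one_mul, hY1, Complex.one_re] at h3
    rw [show cfc g Y = suppPow Y (1 - α) from rfl] at h1
    have h4 : ∑ i, ∑ j, q i j = ∑ i, ∑ j, w i j * (x i * g (y j)) -
        k ^ α * (α * ∑ i, ∑ j, w i j * (z (x i) * 1) -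
          (α - 1) * ∑ i, ∑ j, w i j * (1 * y j)) := by
      simp only [Finset.mul_sum, ← Finset.sum_sub_distrib]
      refine Finset.sum_congr rfl fun i _ => Finset.sum_congr rfl fun j _ => ?_
      simp only [hq]; ring
    rw [h4, ← h1, ← h2, ← h3]; ring
  have hqz : ∀ i j, q i j = 0 := by
    have h1 : ∑ i, ∑ j, q i j = 0 :=
      le_antisymm (by rw [hsum]; linarith)
        (Finset.sum_nonneg fun i _ => Finset.sum_nonneg fun j _ => hq0 i j)
    intro i j
    have h2 := (Finset.sum_eq_zero_iff_of_nonneg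
      (fun i _ => Finset.sum_nonneg fun j _ => hq0 i j)).1 h1 i (Finset.mem_univ _)
    exact (Finset.sum_eq_zero_iff_of_nonneg (fun j _ => hq0 i j)).1 h2 j (Finset.mem_univ _)
  have hzy : ∀ i j, w i j * (z (x i) - y j) ^ 2 = 0 := by
    intro i j
    by_cases h : w i j = 0
    · simp [h]
    · have h1 := hqz i j
      simp only [hq, mul_eq_zero, h, false_or, sub_eq_zero] at h1
      rw [(hterm i j h).2 h1]; simp
  -- All weighted differences vanish, so the Hilbert–Schmidt distance of `Z` and `Y` is zero.
  have hdist : ((Z - Y) * (Z - Y)).trace.re = 0 := by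
    have h1 := htr (fun x => z x * z x) (fun _ => 1)
    have h2 := htr z (fun x => x)
    have h3 := htr (fun _ => 1) (fun x => x * x)
    rw [hY1', cfc_mul_matrix, ← hZc, Matrix.mul_one] at h1
    rw [hYc, ← hZc] at h2
    rw [hX1, cfc_mul_matrix, hYc, Matrix.one_mul] at h3
    rw [Matrix.sub_mul, Matrix.mul_sub, Matrix.mul_sub, trace_sub, trace_sub, trace_sub,
      trace_mul_comm Y Z, Complex.sub_re, Complex.sub_re, Complex.sub_re, h1, h2, h3]
    simp only [← Finset.sum_sub_distrib]
    refine Finset.sum_eq_zero fun i _ => Finset.sum_eq_zero fun j _ => ?_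
    rw [← hzy i j]; ring
  have hZs : (Z - Y)ᴴ = Z - Y := by
    rw [hZc]
    exact (IsSelfAdjoint.sub (cfc_predicate z X) hsY)
  by_contra hne
  have hM : 0 ≤ (Z - Y)ᴴ * (Z - Y) :=
    nonneg_iff_posSemidef.2 (posSemidef_conjTranspose_mul_self _)
  have hM0 : (Z - Y)ᴴ * (Z - Y) ≠ 0 := by
    rw [Ne, conjTranspose_mul_self_eq_zero, sub_eq_zero]
    exact fun h => hne h.symm
  have := trace_re_pos hM hM0
  rw [hZs, hdist] at this
  exact lt_irrefl _ this

end TraceInequality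

/-! ### Minimizers are fixed points of the update maps -/

section Minimizers

variable {a b : Type*} [Fintype a] [DecidableEq a] [Fintype b] [DecidableEq b]
  {ρ : Matrix (a × b) (a × b) ℂ} {σ : Matrix a a ℂ} {τ : Matrix b b ℂ} {α : ℝ}

lemma IsState.nonneg {n : Type*} [Fintype n] [DecidableEq n] {X : Matrix n n ℂ} (h : IsState X) :
    0 ≤ X :=
  nonneg_iff_posSemidef.2 h.1

lemma IsState.ne_zero {n : Type*} [Fintype n] [DecidableEq n] {X : Matrix n n ℂ} (h : IsState X) :
    X ≠ 0 := by
  rintro rfl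
  simpa using h.2

lemma IsState.swapSys (h : IsState ρ) : IsState (swapSys ρ) :=
  ⟨nonneg_iff_posSemidef.1 (swapSys_nonneg h.nonneg), by rw [trace_swapSys, h.2]⟩

lemma IsState.trA (h : IsState ρ) : IsState (trA ρ) :=
  ⟨nonneg_iff_posSemidef.1 (trA_nonneg h.nonneg), by rw [trace_trA, h.2]⟩

lemma IsState.trB (h : IsState ρ) : IsState (trB ρ) := by
  rw [← trA_swapSys]
  exact h.swapSys.trA

lemma ne_zero_of_dom {n : Type*} [Fintype n] [DecidableEq n] {X Y : Matrix n n ℂ} (hX : 0 ≤ X)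
    (hX0 : X ≠ 0) (h : Dom X Y) : Y ≠ 0 := by
  rintro rfl
  obtain ⟨t, -, h⟩ := h
  rw [smul_zero] at h
  exact hX0 (le_antisymm h hX)

lemma dom_refl {n : Type*} [Fintype n] [DecidableEq n] (X : Matrix n n ℂ) : Dom X X :=
  ⟨1, zero_le_one, by rw [one_smul]⟩

/-- The objective function in terms of the bilinear form `(X, T) ↦ tr[ρ ^ α (X ⊗ T)]`. -/
lemma petzD_kronecker (hρ : 0 ≤ ρ) (hσ : 0 ≤ σ) (hτ : 0 ≤ τ)
    (h1 : Dom (trB ρ) σ) (h2 : Dom (trA ρ) τ) :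
    petzD α ρ (kronecker σ τ) = ((1 / (α - 1) * Real.log ((partialMap (suppPow ρ α)
      (suppPow σ (1 - α)) * suppPow τ (1 - α)).trace.re) : ℝ) : EReal) := by
  have hστ : 0 ≤ σ ⊗ₖ τ := nonneg_iff_posSemidef.2
      ((nonneg_iff_posSemidef.1 hσ).kronecker (nonneg_iff_posSemidef.1 hτ))
  rw [petzD, if_pos, trace_partialMap_mul, ← suppPow_kronecker hσ hτ]
  · rfl
  · right
    exact (absCont_iff_dom hρ hστ).2 ((dom_kronecker_iff hρ hσ hτ).2 ⟨h1, h2⟩)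

lemma petzD_kronecker_eq_top (hα : 1 < α) (hρ : 0 ≤ ρ) (hσ : 0 ≤ σ) (hτ : 0 ≤ τ)
    (h : ¬ (Dom (trB ρ) σ ∧ Dom (trA ρ) τ)) : petzD α ρ (kronecker σ τ) = ⊤ := by
  have hστ : 0 ≤ σ ⊗ₖ τ := nonneg_iff_posSemidef.2
      ((nonneg_iff_posSemidef.1 hσ).kronecker (nonneg_iff_posSemidef.1 hτ))
  rw [petzD, if_neg]
  rintro (h1 | h1)
  · linarith [h1.1]
  · exact h ((dom_kronecker_iff hρ hσ hτ).1 ((absCont_iff_dom hρ hστ).1 h1))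

lemma petzD_swapSys (hα : 1 < α) (hρ : 0 ≤ ρ) (hσ : 0 ≤ σ) (hτ : 0 ≤ τ) :
    petzD α (swapSys ρ) (kronecker τ σ) = petzD α ρ (kronecker σ τ) := by
  by_cases h : Dom (trB ρ) σ ∧ Dom (trA ρ) τ
  · rw [petzD_kronecker hρ hσ hτ h.1 h.2,
      petzD_kronecker (swapSys_nonneg hρ) hτ hσ h.2 h.1, suppPow_swapSys hρ,
      trace_partialMap_swapSys_mul]
  · rw [petzD_kronecker_eq_top hα hρ hσ hτ h,
      petzD_kronecker_eq_top hα (swapSys_nonneg hρ) hτ hσ fun h' => h h'.symm]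

lemma IsMinimizer.swapSys (hα : 1 < α) (hρ : 0 ≤ ρ) (h : IsMinimizer α ρ σ τ) :
    IsMinimizer α (swapSys ρ) τ σ :=
  ⟨h.2.1, h.1, fun τ' σ' hτ' hσ' => by
    rw [petzD_swapSys hα hρ h.1.nonneg h.2.1.nonneg, petzD_swapSys hα hρ hσ'.nonneg hτ'.nonneg]
    exact h.2.2 σ' τ' hσ' hτ'⟩

lemma Dom.partialMap {Z : Matrix (a × b) (a × b) ℂ} (hZ : 0 ≤ Z) {X Y : Matrix a a ℂ}
    (h : Dom X Y) : Dom (partialMap Z X) (partialMap Z Y) := by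
  obtain ⟨t, ht, h⟩ := h
  exact ⟨t, ht, by rw [← map_smul]; exact partialMap_mono hZ h⟩

lemma Dom.partialMap_left {Z W : Matrix (a × b) (a × b) ℂ} (h : Dom Z W) {X : Matrix a a ℂ}
    (hX : 0 ≤ X) : Dom (PetzMI.partialMap Z X) (PetzMI.partialMap W X) := by
  obtain ⟨t, ht, h⟩ := h
  exact ⟨t, ht, by rw [← partialMap_smul_left]; exact partialMap_mono_left h hX⟩

/-- As long as `σ` dominates the marginal on `A`, the support of `tr_A[ρ ^ α σ ^ q]` is that of the
marginal on `B`. -/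
lemma dom_partialMap_suppPow (hρ : 0 ≤ ρ) (hσ : 0 ≤ σ) (h : Dom (trB ρ) σ) (q : ℝ) :
    Dom (trA ρ) (partialMap (suppPow ρ α) (suppPow σ q)) ∧
      Dom (partialMap (suppPow ρ α) (suppPow σ q)) (trA ρ) := by
  have hρα := suppPow_nonneg hρ α
  have h1 := dom_suppPow hρ α 1
  have h2 := dom_suppPow hρ 1 α
  rw [suppPow_one hρ] at h1 h2
  constructor
  · have h3 : partialMap ρ (kerProj σ) = 0 := by
      have := congrArg PetzMI.trA (mul_kerProj_kronecker hρ hσ h)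
      rw [show (0 : Matrix b b ℂ) = PetzMI.trA (0 : Matrix (a × b) (a × b) ℂ) by ext; simp [trA],
        ← this]
      rfl
    have h4 : PetzMI.trA ρ = partialMap ρ (suppPow σ 0) := by
      rw [← partialMap_one, ← suppPow_zero_add_kerProj hσ, map_add, h3, add_zero]
    -- `tr_A[ρ] = tr_A[ρ (σ ^ 0 ⊗ 1)]`, and `ρ`, `σ ^ 0` are dominated by `ρ ^ α`, `σ ^ q`.
    rw [h4]
    exact (h2.partialMap_left (suppPow_nonneg hσ 0)).trans (Dom.partialMap hρα (dom_suppPow hσ 0 q))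
  · rw [← partialMap_one]
    exact (Dom.partialMap hρα (dom_one (suppPow_nonneg hσ q))).trans
      (h1.partialMap_left zero_le_one)

lemma trace_eq_ofReal {n : Type*} [Fintype n] [DecidableEq n] {X : Matrix n n ℂ} (hX : 0 ≤ X) :
    X.trace = ((X.trace.re : ℝ) : ℂ) :=
  Complex.ext rfl (Complex.le_def.1 (nonneg_iff_posSemidef.1 hX).trace_nonneg).2.symm

/-- The normalization constant of the update map is a positive real number. -/
lemma stepAB_eq_smul (hρ : IsState ρ) (hσ : 0 ≤ σ) (h : Dom (trB ρ) σ) :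
    0 < (preAB α ρ σ).trace.re ∧
      stepAB α ρ σ = (preAB α ρ σ).trace.re⁻¹ • preAB α ρ σ := by
  have h1 := (dom_partialMap_suppPow (α := α) hρ.nonneg hσ h (1 - α)).1
  have hY := partialMap_nonneg (suppPow_nonneg hρ.nonneg α) (suppPow_nonneg hσ (1 - α))
  have h2 := dom_suppPow hY 1 (1 / α)
  rw [suppPow_one hY] at h2
  have h3 := suppPow_nonneg hY (1 / α)
  have h4 := ne_zero_of_dom hρ.trA.nonneg hρ.trA.ne_zero (h1.trans h2)
  refine ⟨trace_re_pos h3 h4, ?_⟩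
  rw [stepAB, trace_eq_ofReal (X := preAB α ρ σ) h3, ← Complex.ofReal_inv]
  rfl

lemma Dom.smul_left {n : Type*} [Fintype n] [DecidableEq n] {X Y : Matrix n n ℂ} {c : ℝ}
    (hc : 0 ≤ c) (h : Dom X Y) : Dom (c • X) Y := by
  obtain ⟨t, ht, h⟩ := h
  exact ⟨c * t, by positivity, by rw [mul_smul]; exact smul_le_smul_of_nonneg_left h hc⟩

lemma Dom.smul_right {n : Type*} [Fintype n] [DecidableEq n] {X Y : Matrix n n ℂ} {c : ℝ}
    (hc : 0 < c) (h : Dom X Y) : Dom X (c • Y) := by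
  obtain ⟨t, ht, h⟩ := h
  exact ⟨t / c, by positivity, by rwa [smul_smul, div_mul_cancel₀ _ hc.ne']⟩

lemma stepAB_isState (hρ : IsState ρ) (hσ : 0 ≤ σ) (h : Dom (trB ρ) σ) :
    IsState (stepAB α ρ σ) := by
  obtain ⟨h1, h2⟩ := stepAB_eq_smul (α := α) hρ hσ h
  have hY := partialMap_nonneg (suppPow_nonneg hρ.nonneg α) (suppPow_nonneg hσ (1 - α))
  have h3 : 0 ≤ preAB α ρ σ := suppPow_nonneg hY (1 / α)
  refine ⟨?_, ?_⟩
  · rw [h2]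
    exact nonneg_iff_posSemidef.1 (smul_nonneg (inv_pos.2 h1).le h3)
  · rw [stepAB, trace_smul, smul_eq_mul, inv_mul_cancel₀]
    intro h4
    rw [h4] at h1
    simp at h1

lemma stepAB_dom (hρ : IsState ρ) (hσ : 0 ≤ σ) (h : Dom (trB ρ) σ) :
    Dom (trA ρ) (stepAB α ρ σ) ∧ Dom (stepAB α ρ σ) (trA ρ) := by
  obtain ⟨h1, h2⟩ := stepAB_eq_smul (α := α) hρ hσ h
  obtain ⟨h3, h4⟩ := dom_partialMap_suppPow (α := α) hρ.nonneg hσ h (1 - α)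
  have hY := partialMap_nonneg (suppPow_nonneg hρ.nonneg α) (suppPow_nonneg hσ (1 - α))
  have h5 := dom_suppPow hY 1 (1 / α)
  have h6 := dom_suppPow hY (1 / α) 1
  rw [suppPow_one hY] at h5 h6
  rw [h2]
  exact ⟨(h3.trans h5).smul_right (inv_pos.2 h1), (h6.trans h4).smul_left (inv_pos.2 h1).le⟩

lemma IsMinimizer.dom (hα : 1 < α) (hρ : IsState ρ) (h : IsMinimizer α ρ σ τ) :
    Dom (PetzMI.trB ρ) σ ∧ Dom (PetzMI.trA ρ) τ := by
  by_contra hn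
  have h1 := h.2.2 _ _ hρ.trB hρ.trA
  rw [petzD_kronecker_eq_top hα hρ.nonneg h.1.nonneg h.2.1.nonneg hn,
    petzD_kronecker hρ.nonneg hρ.trB.nonneg hρ.trA.nonneg (dom_refl _) (dom_refl _)] at h1
  exact absurd h1 (not_le.2 (EReal.coe_lt_top _))

/-- A minimizer is a fixed point of alternating minimization. -/
lemma IsMinimizer.eq_stepAB (hα : 1 < α) (hρ : IsState ρ) (h : IsMinimizer α ρ σ τ) :
    τ = stepAB α ρ σ := by
  obtain ⟨hd1, hd2⟩ := h.dom hα hρ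
  have hσ := h.1.nonneg
  have hτ := h.2.1.nonneg
  obtain ⟨h1, h2⟩ := stepAB_eq_smul (α := α) hρ hσ hd1
  have hs := stepAB_isState (α := α) hρ hσ hd1
  have h3 := h.2.2 σ _ h.1 hs
  set Y := PetzMI.partialMap (suppPow ρ α) (suppPow σ (1 - α)) with hYdef
  have hY : 0 ≤ Y := partialMap_nonneg (suppPow_nonneg hρ.nonneg α) (suppPow_nonneg hσ (1 - α))
  rw [petzD_kronecker hρ.nonneg hσ hτ hd1 hd2,
    petzD_kronecker hρ.nonneg hσ hs.nonneg hd1 (stepAB_dom (α := α) hρ hσ hd1).1, h2, preAB_eq,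
    ← hYdef, trace_mul_suppPow_eq hα hY (by rwa [preAB_eq] at h1) rfl, EReal.coe_le_coe_iff,
    mul_le_mul_iff_right₀ (by simpa using hα)] at h3
  rw [h2]
  refine eq_of_trace_mul_suppPow_le hα hY hτ h.2.1.2
    ((dom_partialMap_suppPow (α := α) hρ.nonneg hσ hd1 _).2.trans hd2) h1 rfl ?_
  have hk : 0 < (suppPow Y (1 / α)).trace.re ^ α := Real.rpow_pos_of_pos h1 α
  by_cases h4 : 0 < (Y * suppPow τ (1 - α)).trace.re
  · exact (Real.log_le_log_iff h4 hk).1 h3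
  · exact (not_lt.1 h4).trans hk.le

end Minimizers

/-! ### Linear convergence from a contraction factor -/

section Convergence

variable {a b : Type*} [Fintype a] [DecidableEq a] [Fintype b] [DecidableEq b]
  {ρ : Matrix (a × b) (a × b) ℂ} {α : ℝ}

/-- The map `X ↦ tr_A[Z (X ⊗ 1)]` contracts Hilbert's projective metric by the factor `κ`. -/
def ContractsBy (Z : Matrix (a × b) (a × b) ℂ) (κ : ℝ) : Prop :=
  ∀ (X Y : Matrix a a ℂ) (d : ℝ), 0 ≤ X → 0 ≤ Y → 0 ≤ d → HilbertLE X Y d →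
    HilbertLE (partialMap Z X) (partialMap Z Y) (κ * d)

lemma contractsBy_one {Z : Matrix (a × b) (a × b) ℂ} (hZ : 0 ≤ Z) : ContractsBy Z 1 := by
  rintro X Y d - - - ⟨s, t, hs, ht, h1, h2, h3⟩
  refine ⟨s, t, hs, ht, ?_, ?_, by rwa [one_mul]⟩
  · rw [← map_smul]; exact partialMap_mono hZ h1
  · rw [← map_smul]; exact partialMap_mono hZ h2

/-- One update contracts Hilbert's metric by `(1 - 1 / α) κ`: the powers `1 - α` and `1 / α`
contribute the factors `α - 1` and `1 / α`, the partial trace map the factor `κ`. -/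
lemma hilbertLE_stepAB (hα : 1 < α) (hα' : α ≤ 2) (hρ : IsState ρ) {κ : ℝ}
    (hκ : ContractsBy (suppPow ρ α) κ) {σ σ' : Matrix a a ℂ} {d : ℝ} (hσ : 0 ≤ σ)
    (hσ' : 0 ≤ σ') (h : Dom (trB ρ) σ) (h' : Dom (trB ρ) σ') (hd : 0 ≤ d)
    (hH : HilbertLE σ σ' d) :
    HilbertLE (stepAB α ρ σ) (stepAB α ρ σ') ((1 - 1 / α) * κ * d) := by
  have hρα := suppPow_nonneg hρ.nonneg α
  have h1 : HilbertLE (suppPow σ (1 - α)) (suppPow σ' (1 - α)) ((α - 1) * d) := by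
    have := hH.suppPow_neg (p := α - 1) (by linarith) (by linarith) hσ hσ'
    rwa [neg_sub] at this
  have h2 := hκ _ _ _ (suppPow_nonneg hσ _) (suppPow_nonneg hσ' _)
    (mul_nonneg (by linarith) hd) h1
  have h3 := h2.suppPow (q := 1 / α) (by positivity)
    (by rw [div_le_one (by linarith)]; exact hα.le)
    (partialMap_nonneg hρα (suppPow_nonneg hσ _)) (partialMap_nonneg hρα (suppPow_nonneg hσ' _))
  obtain ⟨h4, h5⟩ := stepAB_eq_smul (α := α) hρ hσ h
  obtain ⟨h6, h7⟩ := stepAB_eq_smul (α := α) hρ hσ' h'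
  rw [h5, h7]
  refine HilbertLE.smul (inv_pos.2 h4) (inv_pos.2 h6) ?_
  rw [preAB_eq, preAB_eq]
  convert h3 using 1
  field_simp

lemma iterA_spec (hρ : IsState ρ) {σ₀ : Matrix a a ℂ} (hσ₀ : IsState σ₀)
    (h : Dom (trB ρ) σ₀) (k : ℕ) : IsState (iterA α ρ σ₀ k) ∧ Dom (trB ρ) (iterA α ρ σ₀ k) := by
  induction k with
  | zero => exact ⟨hσ₀, h⟩
  | succ k ih =>
    have h1 := stepAB_isState (α := α) hρ ih.1.nonneg ih.2
    have h2 := (stepAB_dom (α := α) hρ ih.1.nonneg ih.2).1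
    rw [iterA, stepBA_eq α hρ.nonneg]
    rw [← trB_swapSys] at h2
    refine ⟨stepAB_isState (α := α) hρ.swapSys h1.nonneg h2, ?_⟩
    have := (stepAB_dom (α := α) hρ.swapSys h1.nonneg h2).1
    rwa [trA_swapSys] at this

lemma IsMinimizer.eq_stepBA {σ : Matrix a a ℂ} {τ : Matrix b b ℂ} (hα : 1 < α) (hρ : IsState ρ)
    (h : IsMinimizer α ρ σ τ) : σ = stepBA α ρ τ := by
  rw [stepBA_eq α hρ.nonneg]
  exact (h.swapSys hα hρ.nonneg).eq_stepAB hα hρ.swapSys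

lemma hilbertLE_iter (hα : 1 < α) (hα' : α ≤ 2) (hρ : IsState ρ) {κ : ℝ}
    (hκA : ContractsBy (suppPow ρ α) κ) (hκB : ContractsBy (swapSys (suppPow ρ α)) κ)
    (hκ0 : 0 ≤ κ) {σ σ₀ : Matrix a a ℂ} {τ : Matrix b b ℂ} (hmin : IsMinimizer α ρ σ τ)
    (hσ₀ : IsState σ₀) (h : Dom (trB ρ) σ₀) {d : ℝ} (hd : 0 ≤ d) (hH : HilbertLE σ₀ σ d) (k : ℕ) :
    HilbertLE (iterA α ρ σ₀ k) σ (((1 - 1 / α) * κ) ^ (2 * k) * d) ∧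
      HilbertLE (iterB α ρ σ₀ k) τ (((1 - 1 / α) * κ) ^ (2 * k + 1) * d) := by
  have hr : 0 ≤ (1 - 1 / α) * κ := by
    refine mul_nonneg (sub_nonneg.2 ?_) hκ0
    rw [div_le_one (by linarith)]; exact hα.le
  have hdom := hmin.dom hα hρ
  have hAB : ∀ j, HilbertLE (iterA α ρ σ₀ j) σ (((1 - 1 / α) * κ) ^ (2 * j) * d) →
      HilbertLE (iterB α ρ σ₀ j) τ (((1 - 1 / α) * κ) ^ (2 * j + 1) * d) := by
    intro j hj
    obtain ⟨h1, h2⟩ := iterA_spec (α := α) hρ hσ₀ h j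
    have := hilbertLE_stepAB hα hα' hρ hκA h1.nonneg hmin.1.nonneg h2 hdom.1
      (by positivity) hj
    rw [← hmin.eq_stepAB hα hρ] at this
    rw [pow_succ', mul_assoc]
    exact this
  suffices hA : HilbertLE (iterA α ρ σ₀ k) σ (((1 - 1 / α) * κ) ^ (2 * k) * d) from ⟨hA, hAB k hA⟩
  induction k with
  | zero => simpa [iterA] using hH
  | succ j ih =>
    obtain ⟨h1, h2⟩ := iterA_spec (α := α) hρ hσ₀ h j
    have h3 := stepAB_isState (α := α) hρ h1.nonneg h2
    have h4 := (stepAB_dom (α := α) hρ h1.nonneg h2).1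
    rw [← trB_swapSys] at h4
    have := hilbertLE_stepAB hα hα' hρ.swapSys
      (by rwa [suppPow_swapSys hρ.nonneg]) h3.nonneg hmin.2.1.nonneg h4
      (by rw [trB_swapSys]; exact hdom.2) (by positivity) (hAB j ih)
    rw [← stepBA_eq α hρ.nonneg, ← stepBA_eq α hρ.nonneg, ← hmin.eq_stepBA hα hρ] at this
    rw [show 2 * (j + 1) = 2 * j + 1 + 1 by ring, pow_succ', mul_assoc]
    exact this

lemma trace_mul_re_nonneg {n : Type*} [Fintype n] [DecidableEq n] {X Y : Matrix n n ℂ}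
    (hX : 0 ≤ X) (hY : 0 ≤ Y) : 0 ≤ (X * Y).trace.re := by
  obtain ⟨C, rfl⟩ := CStarAlgebra.nonneg_iff_eq_star_mul_self.1 hY
  rw [← Matrix.mul_assoc, trace_mul_comm, star_eq_conjTranspose, ← Matrix.mul_assoc]
  exact (Complex.le_def.1
    ((nonneg_iff_posSemidef.1 hX).mul_mul_conjTranspose_same C).trace_nonneg).1

lemma trace_mul_re_mono {n : Type*} [Fintype n] [DecidableEq n] {X Y T : Matrix n n ℂ}
    (h : X ≤ Y) (hT : 0 ≤ T) : (X * T).trace.re ≤ (Y * T).trace.re := by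
  have := trace_mul_re_nonneg (sub_nonneg.2 h) hT
  rwa [Matrix.sub_mul, trace_sub, Complex.sub_re, sub_nonneg] at this

lemma HilbertLE.suppPow_le_smul {n : Type*} [Fintype n] [DecidableEq n] {X Y : Matrix n n ℂ}
    {d : ℝ} (hα : 1 < α) (hα' : α ≤ 2) (hX : IsState X) (hY : IsState Y) (h : HilbertLE X Y d) :
    PetzMI.suppPow X (1 - α) ≤ Real.exp ((α - 1) * d) • PetzMI.suppPow Y (1 - α) := by
  have h1 := h.le_exp_smul hX.nonneg hX.2 hY.2
  have h2 := suppPow_neg_le_suppPow_neg (p := α - 1) (by linarith) (by linarith) (Real.exp_pos d)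
    hY.nonneg hX.nonneg h1 (kerProj_eq_of_dom hY.nonneg hX.nonneg h.dom.2 h.dom.1)
  rwa [neg_sub, ← Real.exp_mul, mul_comm d] at h2

/-- The value of the objective function changes by at most the sum of the distances of the
arguments. -/
lemma log_trace_le (hα : 1 < α) (hα' : α ≤ 2) {Z : Matrix (a × b) (a × b) ℂ} (hZ : 0 ≤ Z)
    {σ σ' : Matrix a a ℂ} {τ τ' : Matrix b b ℂ} (hσ : IsState σ) (hσ' : IsState σ')
    (hτ : IsState τ) (hτ' : IsState τ') {d e : ℝ} (hd : HilbertLE σ σ' d) (he : HilbertLE τ τ' e)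
    (hpos : 0 < (partialMap Z (suppPow σ (1 - α)) * suppPow τ (1 - α)).trace.re) :
    1 / (α - 1) * Real.log (partialMap Z (suppPow σ (1 - α)) * suppPow τ (1 - α)).trace.re ≤
      1 / (α - 1) * Real.log (partialMap Z (suppPow σ' (1 - α)) * suppPow τ' (1 - α)).trace.re
        + (d + e) := by
  have hp : 0 < α - 1 := by linarith
  have h1 := trace_mul_re_mono (partialMap_mono hZ (hd.suppPow_le_smul hα hα' hσ hσ'))
    (suppPow_nonneg hτ.nonneg (1 - α))
  have h2 := trace_mul_re_mono (he.suppPow_le_smul hα hα' hτ hτ')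
    (partialMap_nonneg hZ (suppPow_nonneg hσ'.nonneg (1 - α)))
  rw [map_smul, Matrix.smul_mul, trace_smul, Complex.smul_re, smul_eq_mul] at h1
  rw [Matrix.smul_mul, trace_smul, Complex.smul_re, smul_eq_mul, trace_mul_comm,
    trace_mul_comm (suppPow τ' _)] at h2
  have h3 := h1.trans (mul_le_mul_of_nonneg_left h2 (Real.exp_pos _).le)
  rw [← mul_assoc, ← Real.exp_add] at h3
  set Q := (partialMap Z (suppPow σ (1 - α)) * suppPow τ (1 - α)).trace.re
  set Q' := (partialMap Z (suppPow σ' (1 - α)) * suppPow τ' (1 - α)).trace.re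
  have hQ' : 0 < Q' := by
    by_contra! hn
    have := mul_nonpos_of_nonneg_of_nonpos (Real.exp_pos ((α - 1) * d + (α - 1) * e)).le hn
    linarith
  have h4 := Real.log_le_log hpos h3
  rw [Real.log_mul (Real.exp_pos _).ne' hQ'.ne', Real.log_exp] at h4
  have h5 := mul_le_mul_of_nonneg_left h4 (by positivity : 0 ≤ 1 / (α - 1))
  refine h5.trans_eq ?_
  field_simp
  ring

/-- The quantity under the logarithm in the objective function is positive. -/
lemma trace_pos_of_dom (hρ : IsState ρ) {σ : Matrix a a ℂ} {τ : Matrix b b ℂ}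
    (hσ : 0 ≤ σ) (hτ : 0 ≤ τ) (h1 : Dom (trB ρ) σ) (h2 : Dom (trA ρ) τ) :
    0 < (partialMap (suppPow ρ α) (suppPow σ (1 - α)) * suppPow τ (1 - α)).trace.re := by
  set Y := partialMap (suppPow ρ α) (suppPow σ (1 - α)) with hYdef
  have hY : 0 ≤ Y := partialMap_nonneg (suppPow_nonneg hρ.nonneg α) (suppPow_nonneg hσ (1 - α))
  obtain ⟨h3, h4⟩ := dom_partialMap_suppPow (α := α) hρ.nonneg hσ h1 (1 - α)
  have hY0 := ne_zero_of_dom hρ.trA.nonneg hρ.trA.ne_zero h3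
  have hdom := h4.trans h2
  have h5 := dom_suppPow hτ 0 (1 - α)
  obtain ⟨t, ht, h5⟩ := h5
  have h6 := trace_mul_re_mono h5 hY
  have h7 : suppPow τ 0 = 1 - kerProj τ := eq_sub_of_add_eq (suppPow_zero_add_kerProj hτ)
  rw [trace_mul_comm, h7, Matrix.mul_sub, hdom.mul_kerProj hY hτ, sub_zero, Matrix.mul_one,
    Matrix.smul_mul, trace_smul, Complex.smul_re, smul_eq_mul, trace_mul_comm] at h6
  have h8 := (trace_re_pos hY hY0).trans_le h6
  exact pos_of_mul_pos_right h8 ht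

/-- Finiteness of the objective values and of the minimum, and the rate of convergence that results
from a contraction factor `κ` of the two partial trace maps. -/
lemma exists_objVal_bound (hα : 1 < α) (hα' : α ≤ 2) (hρ : IsState ρ)
    {σ σ₀ : Matrix a a ℂ} {τ : Matrix b b ℂ} (hmin : IsMinimizer α ρ σ τ)
    (hσ₀ : IsState σ₀) (h : Dom (trB ρ) σ₀) :
    ∃ (x : ℕ → ℝ) (I : ℝ), (∀ k, objVal α ρ σ₀ k = (x k : EReal)) ∧ prmi α ρ = (I : EReal) ∧
      ∀ (κ d : ℝ), ContractsBy (suppPow ρ α) κ → ContractsBy (swapSys (suppPow ρ α)) κ → 0 ≤ κ →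
        0 ≤ d → HilbertLE σ₀ σ d → ∀ k, |x k - I| ≤
          (1 + (1 - 1 / α) * κ) * ((1 - 1 / α) * κ) ^ (2 * k) * d := by
  have hdom := hmin.dom hα hρ
  have hA := iterA_spec (α := α) hρ hσ₀ h
  have hB : ∀ k, IsState (iterB α ρ σ₀ k) := fun k =>
    stepAB_isState (α := α) hρ (hA k).1.nonneg (hA k).2
  have hBd : ∀ k, Dom (trA ρ) (iterB α ρ σ₀ k) :=
    fun k => (stepAB_dom (α := α) hρ (hA k).1.nonneg (hA k).2).1
  have hx := fun k => petzD_kronecker (α := α) hρ.nonneg (hA k).1.nonneg (hB k).nonneg (hA k).2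
    (hBd k)
  have hI := petzD_kronecker (α := α) hρ.nonneg hmin.1.nonneg hmin.2.1.nonneg hdom.1 hdom.2
  refine ⟨_, 1 / (α - 1) * Real.log ((partialMap (suppPow ρ α)
      (suppPow σ (1 - α)) * suppPow τ (1 - α)).trace.re), hx, ?_, ?_⟩
  · rw [← hI, prmi]
    refine le_antisymm (sInf_le ⟨σ, τ, hmin.1, hmin.2.1, rfl⟩) (le_sInf ?_)
    rintro v ⟨σ', τ', h1, h2, rfl⟩
    exact hmin.2.2 σ' τ' h1 h2
  · intro κ d hκA hκB hκ0 hd hH k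
    obtain ⟨h1, h2⟩ := hilbertLE_iter hα hα' hρ hκA hκB hκ0 hmin hσ₀ h hd hH k
    have h3 := hmin.2.2 _ _ (hA k).1 (hB k)
    rw [hI, hx k, EReal.coe_le_coe_iff] at h3
    rw [abs_of_nonneg (sub_nonneg.2 h3), sub_le_iff_le_add']
    refine (log_trace_le hα hα' (suppPow_nonneg hρ.nonneg α) (hA k).1 hmin.1 (hB k) hmin.2.1 h1 h2
      (trace_pos_of_dom (α := α) hρ (hA k).1.nonneg (hB k).nonneg (hA k).2 (hBd k))).trans_eq ?_
    ring

end Convergence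

/-! ### The Birkhoff–Hopf theorem -/

section BirkhoffHopf

lemma tanh_log_div_four {m : ℝ} (hm : 0 < m) :
    Real.tanh (Real.log m / 4) = (√m - 1) / (√m + 1) := by
  have h : √m = Real.exp (Real.log m / 4) * Real.exp (Real.log m / 4) := by
    rw [← Real.exp_add, Real.sqrt_eq_rpow, Real.rpow_def_of_pos hm]
    ring_nf
  rw [h, Real.tanh_eq_sinh_div_cosh, Real.sinh_eq, Real.cosh_eq, Real.exp_neg]
  have := Real.exp_pos (Real.log m / 4)
  field_simp

/-- With `x = u ^ 2` and `y = v ^ 2`, this combines `(u + v) ^ 2 ≤ (1 + u ^ 2) (1 + v ^ 2)` with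
`v ≤ √m u`. -/
lemma div_one_add_sub_le {x y m : ℝ} (hx : 0 < x) (hxy : x ≤ y) (hm : y ≤ m * x) :
    y / (1 + y) - x / (1 + x) ≤ (√m - 1) / (√m + 1) := by
  have hy : 0 < y := hx.trans_le hxy
  have hm0 : 0 < m := pos_of_mul_pos_left (hy.trans_le hm) hx.le
  obtain ⟨u, hu, rfl⟩ : ∃ u : ℝ, 0 < u ∧ x = u ^ 2 :=
    ⟨√x, Real.sqrt_pos.2 hx, (Real.sq_sqrt hx.le).symm⟩
  obtain ⟨v, hv, rfl⟩ : ∃ v : ℝ, 0 < v ∧ y = v ^ 2 :=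
    ⟨√y, Real.sqrt_pos.2 hy, (Real.sq_sqrt hy.le).symm⟩
  obtain ⟨s, hs, rfl⟩ : ∃ s : ℝ, 0 < s ∧ m = s ^ 2 :=
    ⟨√m, Real.sqrt_pos.2 hm0, (Real.sq_sqrt hm0.le).symm⟩
  rw [Real.sqrt_sq hs.le]
  have huv : u ≤ v := le_of_sq_le_sq hxy hv.le
  have hvs : v ≤ s * u := le_of_sq_le_sq (by rwa [mul_pow]) (by positivity)
  calc v ^ 2 / (1 + v ^ 2) - u ^ 2 / (1 + u ^ 2)
      = (v - u) * (v + u) / ((1 + v ^ 2) * (1 + u ^ 2)) := by field_simp; ring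
    _ ≤ (v - u) / (v + u) := by
        rw [div_le_div_iff₀ (by positivity) (by positivity)]
        have : (v + u) * (v + u) ≤ (1 + v ^ 2) * (1 + u ^ 2) := by nlinarith [sq_nonneg (u * v - 1)]
        nlinarith [mul_le_mul_of_nonneg_left this (sub_nonneg.2 huv)]
    _ ≤ (s - 1) / (s + 1) := by
        rw [div_le_div_iff₀ (by positivity) (by positivity)]
        nlinarith

/-- The scalar inequality behind the Birkhoff–Hopf theorem: the left-hand side has derivative at
most `tanh (log m / 4)` in `D`. -/
lemma log_crossRatio_le {c C m D : ℝ} (hc : 0 < c) (hcC : c ≤ C) (hm : C ≤ m * c) (hD : 0 ≤ D) :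
    Real.log ((1 + C * Real.exp D) * (1 + c) / ((1 + C) * (1 + c * Real.exp D))) ≤
      Real.tanh (Real.log m / 4) * D := by
  have hC : 0 < C := hc.trans_le hcC
  have hm0 : 0 < m := pos_of_mul_pos_left (hC.trans_le hm) hc.le
  set κ := Real.tanh (Real.log m / 4) with hκ
  let F : ℝ → ℝ := fun t => κ * t - Real.log (1 + C * Real.exp t) + Real.log (1 + c * Real.exp t)
  have hderiv : ∀ t, HasDerivAt F (κ * 1 - (C * Real.exp t) / (1 + C * Real.exp t) +
      (c * Real.exp t) / (1 + c * Real.exp t)) t := by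
    intro t
    have hlog : ∀ k : ℝ, 0 < k → HasDerivAt (fun t => Real.log (1 + k * Real.exp t))
        ((k * Real.exp t) / (1 + k * Real.exp t)) t := fun k hk =>
      (((Real.hasDerivAt_exp t).const_mul k).const_add 1).log (by positivity)
    exact (((hasDerivAt_id t).const_mul κ).sub (hlog C hC)).add (hlog c hc)
  have hmono : Monotone F := by
    refine monotone_of_deriv_nonneg (fun t => (hderiv t).differentiableAt) fun t => ?_
    rw [(hderiv t).deriv]
    have := div_one_add_sub_le (m := m) (mul_pos hc (Real.exp_pos t))
      (mul_le_mul_of_nonneg_right hcC (Real.exp_pos t).le)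
      (by rw [← mul_assoc]; exact mul_le_mul_of_nonneg_right hm (Real.exp_pos t).le)
    rw [← tanh_log_div_four hm0, ← hκ] at this
    linarith
  have h := hmono hD
  simp only [F, Real.exp_zero, mul_one, mul_zero] at h
  have he := Real.exp_pos D
  rw [Real.log_div (by positivity) (by positivity), Real.log_mul (by positivity) (by positivity),
    Real.log_mul (by positivity) (by positivity)]
  linarith

variable {a b : Type*} [Fintype a] [DecidableEq a] [Fintype b] [DecidableEq b]

lemma le_of_trace_le {X Y : Matrix b b ℂ} (hX : 0 ≤ X) (hY : 0 ≤ Y)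
    (h : ∀ S : Matrix b b ℂ, 0 ≤ S → (X * S).trace.re ≤ (Y * S).trace.re) : X ≤ Y := by
  rw [Matrix.le_iff, posSemidef_iff_dotProduct_mulVec]
  have hs : (Y - X).IsHermitian :=
    (nonneg_iff_posSemidef.1 hY).1.sub (nonneg_iff_posSemidef.1 hX).1
  refine ⟨hs, fun v => ?_⟩
  have h1 := h _ (nonneg_iff_posSemidef.2 (posSemidef_vecMulVec_self_star v))
  rw [← sub_nonneg, ← Complex.sub_re, ← trace_sub, ← Matrix.sub_mul, mul_vecMulVec,
    trace_vecMulVec, dotProduct_comm] at h1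
  exact Complex.le_def.2 ⟨h1, (hs.im_star_dotProduct_mulVec_self v).symm⟩

/-- A bound on the cross ratios `⟨L X, S⟩ ⟨L Y, T⟩ / (⟨L X, T⟩ ⟨L Y, S⟩)` of a positive map `L`. The
logarithm of the best `m` is the projective diameter of the image of `L`; the condition is symmetric
under passing to the adjoint map. -/
def CrossRatioLE (L : Matrix a a ℂ →ₗ[ℝ] Matrix b b ℂ) (m : ℝ) : Prop :=
  ∀ (X Y : Matrix a a ℂ) (S T : Matrix b b ℂ), 0 ≤ X → 0 ≤ Y → 0 ≤ S → 0 ≤ T →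
    (L X * S).trace.re * (L Y * T).trace.re ≤ m * ((L X * T).trace.re * (L Y * S).trace.re)

variable {L : Matrix a a ℂ →ₗ[ℝ] Matrix b b ℂ} {m : ℝ}

lemma CrossRatioLE.le_smul (hL : CrossRatioLE L m) (hpos : ∀ X, 0 ≤ X → 0 ≤ L X) (hm : 1 ≤ m)
    {U V : Matrix a a ℂ} (hU : 0 ≤ U) (hV : 0 ≤ V) {T : Matrix b b ℂ} (hT : 0 ≤ T)
    (hVT : 0 < (L V * T).trace.re) :
    L U ≤ (m * (L U * T).trace.re / (L V * T).trace.re) • L V := by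
  have h0 : 0 ≤ m * (L U * T).trace.re / (L V * T).trace.re := by
    have := trace_mul_re_nonneg (hpos U hU) hT
    positivity
  refine le_of_trace_le (hpos U hU) (smul_nonneg h0 (hpos V hV)) fun S hS => ?_
  rw [Matrix.smul_mul, trace_smul, Complex.smul_re, smul_eq_mul, div_mul_eq_mul_div,
    le_div_iff₀ hVT, mul_assoc]
  exact hL U V S T hU hV hS hT

/-- Any two elements `L U`, `L V` of the image are at distance at most `log m`; the upper constant
`C` is the best one, and the lower one is `C / m`. -/
lemma CrossRatioLE.exists_sandwich (hL : CrossRatioLE L m) (hpos : ∀ X, 0 ≤ X → 0 ≤ L X)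
    (hne : ∀ X, 0 ≤ X → X ≠ 0 → L X ≠ 0) (hm : 1 ≤ m) {U V : Matrix a a ℂ} (hU : 0 ≤ U)
    (hU0 : U ≠ 0) (hV : 0 ≤ V) (hV0 : V ≠ 0) :
    ∃ c C : ℝ, 0 < c ∧ c ≤ C ∧ C ≤ m * c ∧ c • L V ≤ L U ∧ L U ≤ C • L V := by
  have hLU := hpos U hU
  have hLV := hpos V hV
  have hLU0 := hne U hU hU0
  have hLV0 := hne V hV hV0
  have hm0 : 0 < m := by linarith
  have hdom : Dom (L U) (L V) := Dom.of_le_smul hLV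
    (hL.le_smul hpos hm hU hV zero_le_one (by rw [Matrix.mul_one]; exact trace_re_pos hLV hLV0))
  have hC := coneM_pos hLU hLU0 hLV hLV0 hdom
  set C := coneM (psdCone b) (L U) (L V) with hCdef
  refine ⟨C / m, C, by positivity, div_le_self hC.le hm, (mul_div_cancel₀ C hm0.ne').ge, ?_,
    le_coneM_smul hLU hLV hLV0 hdom⟩
  refine le_of_trace_le (smul_nonneg (by positivity) hLV) hLU fun T hT => ?_
  rw [Matrix.smul_mul, trace_smul, Complex.smul_re, smul_eq_mul]
  rcases (trace_mul_re_nonneg hLV hT).eq_or_lt with h | h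
  · rw [← h, mul_zero]
    exact trace_mul_re_nonneg hLU hT
  · have := coneM_le hLU hLV hLV0 (hL.le_smul hpos hm hU hV hT h)
    rw [← hCdef, le_div_iff₀ h] at this
    rw [div_mul_eq_mul_div, div_le_iff₀ hm0]
    linarith

/-- The **Birkhoff–Hopf theorem** (contraction part) for the cone of positive semidefinite
matrices. -/
lemma CrossRatioLE.hilbertLE (hL : CrossRatioLE L m) (hpos : ∀ X, 0 ≤ X → 0 ≤ L X)
    (hne : ∀ X, 0 ≤ X → X ≠ 0 → L X ≠ 0) (hm : 1 ≤ m) {X Y : Matrix a a ℂ} {d : ℝ} (hX : 0 ≤ X)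
    (hY : 0 ≤ Y) (hd : 0 ≤ d) (h : HilbertLE X Y d) :
    HilbertLE (L X) (L Y) (Real.tanh (Real.log m / 4) * d) := by
  obtain ⟨s, t, hs, ht, h1, h2, h3⟩ := h
  have hκ : 0 ≤ Real.tanh (Real.log m / 4) := by
    rw [tanh_log_div_four (by linarith)]
    have : 1 ≤ √m := Real.one_le_sqrt.2 hm
    exact div_nonneg (by linarith) (by linarith)
  have hexp : 1 ≤ Real.exp (Real.tanh (Real.log m / 4) * d) := Real.one_le_exp (by positivity)
  by_cases hU : s • Y - X = 0
  · have hX' : L X = s • L Y := by rw [← map_smul, ← sub_eq_zero.1 hU]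
    refine ⟨s, s⁻¹, hs, inv_pos.2 hs, hX'.le, ?_, by rwa [mul_inv_cancel₀ hs.ne']⟩
    rw [hX', smul_smul, inv_mul_cancel₀ hs.ne', one_smul]
  by_cases hV : t • X - Y = 0
  · have hY' : L Y = t • L X := by rw [← map_smul, ← sub_eq_zero.1 hV]
    refine ⟨t⁻¹, t, inv_pos.2 ht, ht, ?_, hY'.le, by rwa [inv_mul_cancel₀ ht.ne']⟩
    rw [hY', smul_smul, inv_mul_cancel₀ ht.ne', one_smul]
  have hX0 : X ≠ 0 := by
    rintro rfl
    rw [smul_zero] at h2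
    rw [le_antisymm h2 hY] at hU
    simp at hU
  have hst : 1 ≤ s * t := one_le_mul_of_le hX hX0 hs.le h1 h2
  -- The images of `t X - Y` and `s Y - X` are at distance at most `log m`; solving
  -- `c L(s Y - X) ≤ L(t X - Y) ≤ C L(s Y - X)` for `L X` and `L Y` gives the improved constants.
  obtain ⟨c, C, hc, hcC, hCm, h4, h5⟩ := hL.exists_sandwich hpos hne hm (sub_nonneg.2 h2) hV
    (sub_nonneg.2 h1) hU
  have hC : 0 < C := hc.trans_le hcC
  rw [map_sub, map_sub, map_smul, map_smul] at h4 h5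
  have h6 : (t + C) • L X ≤ (1 + C * s) • L Y := by
    rw [← sub_nonneg] at h5 ⊢
    convert h5 using 1
    module
  have h7 : (1 + c * s) • L Y ≤ (t + c) • L X := by
    rw [← sub_nonneg] at h4 ⊢
    convert h4 using 1
    module
  refine ⟨(1 + C * s) / (t + C), (t + c) / (1 + c * s), by positivity, by positivity, ?_, ?_, ?_⟩
  · have := smul_le_smul_of_nonneg_left h6 (by positivity : 0 ≤ (t + C)⁻¹)
    rwa [smul_smul, smul_smul, inv_mul_cancel₀ (by positivity), one_smul, mul_comm] at this
  · have := smul_le_smul_of_nonneg_left h7 (by positivity : 0 ≤ (1 + c * s)⁻¹)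
    rwa [smul_smul, smul_smul, inv_mul_cancel₀ (by positivity), one_smul, mul_comm] at this
  · have hD : Real.log (s * t) ≤ d := by
      rw [← Real.log_exp d]
      exact Real.log_le_log (by positivity) h3
    have h8 := log_crossRatio_le (c := c / t) (C := C / t) (m := m) (by positivity)
      (by gcongr) (by rw [← mul_div_assoc]; gcongr) (Real.log_nonneg hst)
    rw [Real.exp_log (by positivity)] at h8
    have h9 : (1 + C * s) / (t + C) * ((t + c) / (1 + c * s)) =
        (1 + C / t * (s * t)) * (1 + c / t) / ((1 + C / t) * (1 + c / t * (s * t))) := by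
      field_simp
    rw [h9, ← Real.log_le_iff_le_exp (by positivity)]
    exact h8.trans (mul_le_mul_of_nonneg_left hD hκ)

end BirkhoffHopf

/-! ### The projective diameter of the partial trace map -/

section Diameter

variable {a b : Type*} [Fintype a] [DecidableEq a] [Fintype b] [DecidableEq b]
  {R : Matrix (a × b) (a × b) ℂ}

lemma one_dom_of_posDef {n : Type*} [Fintype n] [DecidableEq n] {X : Matrix n n ℂ}
    (hX : X.PosDef) : Dom 1 X := by
  have h0 := nonneg_iff_posSemidef.2 hX.posSemidef
  refine dom_of_mul_kerProj zero_le_one h0 ?_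
  rw [Matrix.one_mul]
  exact (hX.isUnit.mul_right_eq_zero).1 (mul_kerProj_self h0)

lemma sandwich_one {φ : EuclideanSpace ℂ a} (hφ : ‖φ‖ = 1) :
    sandwich (1 : Matrix (a × b) (a × b) ℂ) φ = 1 := by
  have h : ∑ i, star (φ i) * φ i = 1 := by
    have h1 := EuclideanSpace.norm_sq_eq φ
    rw [hφ] at h1
    have h2 : ∑ i, star (φ i) * φ i = ((∑ i, ‖φ i‖ ^ 2 : ℝ) : ℂ) := by
      push_cast
      exact Finset.sum_congr rfl fun i _ => Complex.conj_mul' (φ i)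
    rw [h2, ← h1]; simp
  ext j j'
  simp only [sandwich, of_apply, Matrix.one_apply, Prod.mk.injEq]
  by_cases hj : j = j'
  · simpa [hj] using h
  · simp [hj]

lemma sandwich_mono {Z W : Matrix (a × b) (a × b) ℂ} (h : Z ≤ W) (φ : EuclideanSpace ℂ a) :
    sandwich Z φ ≤ sandwich W φ := by
  rw [← partialMap_rankOne, ← partialMap_rankOne]
  exact partialMap_mono_left h (nonneg_iff_posSemidef.2 (posSemidef_vecMulVec_self_star _))

lemma sandwich_smul (c : ℝ) (Z : Matrix (a × b) (a × b) ℂ) (φ : EuclideanSpace ℂ a) :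
    sandwich (c • Z) φ = c • sandwich Z φ := by
  rw [← partialMap_rankOne, ← partialMap_rankOne, partialMap_smul_left]

/-- The bounds are uniform in `φ`, which gives continuity of the powers of `⟨φ|R|φ⟩` on
the sphere. -/
lemma exists_spectrum_sandwich_subset (hR : R.PosDef) :
    ∃ c C : ℝ, 0 < c ∧ ∀ φ : EuclideanSpace ℂ a, ‖φ‖ = 1 →
      spectrum ℝ (sandwich R φ) ⊆ Set.Icc c C := by
  have hR0 := nonneg_iff_posSemidef.2 hR.posSemidef
  obtain ⟨t, ht, h1⟩ := one_dom_of_posDef hR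
  obtain ⟨C, -, h2⟩ := dom_one hR0
  refine ⟨(t + 1)⁻¹, C, by positivity, fun φ hφ x hx => ?_⟩
  have hs := IsSelfAdjoint.of_nonneg (sandwich_nonneg hR0 φ)
  have h3 : 1 ≤ (t + 1) • R := h1.trans (smul_le_smul_of_nonneg_right (by linarith) hR0)
  have h4 := sandwich_mono h3 φ
  have h5 := sandwich_mono h2 φ
  rw [sandwich_one hφ, sandwich_smul] at h4
  rw [sandwich_smul, sandwich_one hφ] at h5
  have h6 := smul_le_smul_of_nonneg_left h4 (by positivity : 0 ≤ (t + 1)⁻¹)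
  rw [smul_smul, inv_mul_cancel₀ (by positivity), one_smul] at h6
  rw [← Algebra.algebraMap_eq_smul_one] at h5 h6
  exact ⟨(algebraMap_le_iff_le_spectrum hs).1 h6 x hx, (le_algebraMap_iff_spectrum_le hs).1 h5 x hx⟩

lemma suppPow_zero_sandwich (hR : R.PosDef) {φ : EuclideanSpace ℂ a} (hφ : ‖φ‖ = 1) :
    suppPow (sandwich R φ) 0 = 1 := by
  obtain ⟨c, C, hc, h⟩ := exists_spectrum_sandwich_subset hR
  have hs := IsSelfAdjoint.of_nonneg (sandwich_nonneg (nonneg_iff_posSemidef.2 hR.posSemidef) φ)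
  rw [suppPow, ← cfc_one ℝ (sandwich R φ) hs]
  refine cfc_congr fun x hx => ?_
  have := (h φ hφ hx).1
  simp [(hc.trans_le this).ne']

open scoped Matrix.Norms.L2Operator in
lemma opNorm_eq_norm {n : Type*} [Fintype n] [DecidableEq n] (X : Matrix n n ℂ) :
    opNorm X = ‖X‖ := rfl

open scoped Matrix.Norms.L2Operator in
/-- `ratioNorm R φ ψ` is a constant with which `⟨φ|R|φ⟩` dominates `⟨ψ|R|ψ⟩`. -/
lemma sandwich_le_ratioNorm_smul (hR : R.PosDef) {φ ψ : EuclideanSpace ℂ a} (hφ : ‖φ‖ = 1) :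
    sandwich R ψ ≤ ratioNorm R φ ψ • sandwich R φ := by
  have hR0 := nonneg_iff_posSemidef.2 hR.posSemidef
  have hS := sandwich_nonneg hR0 φ
  have hW := sandwich_nonneg hR0 ψ
  have h1 := suppPow_zero_sandwich hR hφ
  rw [ratioNorm]
  set S := sandwich R φ
  set W := sandwich R ψ
  have hTs : ∀ p, (suppPow S p)ᴴ = suppPow S p :=
    fun p => IsSelfAdjoint.of_nonneg (suppPow_nonneg hS p)
  set M := suppPow S (-1 / 2) * W * suppPow S (-1 / 2) with hM
  have hM0 : 0 ≤ M := by
    have := conj_le_conj hW (suppPow S (-1 / 2))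
    rwa [hTs, Matrix.mul_zero, Matrix.zero_mul] at this
  have h2 : M ≤ opNorm M • (1 : Matrix b b ℂ) := by
    rw [opNorm_eq_norm, ← Algebra.algebraMap_eq_smul_one]
    exact IsSelfAdjoint.le_algebraMap_norm_self (IsSelfAdjoint.of_nonneg hM0)
  have h3 := conj_le_conj h2 (suppPow S (1 / 2))
  have h4 : suppPow S (1 / 2) * suppPow S (-1 / 2) = 1 := by
    rw [suppPow_mul_suppPow hS, ← h1]; norm_num
  have h5 : suppPow S (-1 / 2) * suppPow S (1 / 2) = 1 := by
    rw [suppPow_mul_suppPow hS, ← h1]; norm_num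
  have h6 : suppPow S (1 / 2) * suppPow S (1 / 2) = S := by
    rw [suppPow_mul_suppPow hS]; norm_num [suppPow_one hS]
  rw [hTs, Matrix.mul_smul, Matrix.mul_one, Matrix.smul_mul, h6, hM, Matrix.mul_assoc,
    Matrix.mul_assoc, Matrix.mul_assoc, h5, Matrix.mul_one, ← Matrix.mul_assoc, h4,
    Matrix.one_mul] at h3
  rw [hM]
  convert h3 using 3

lemma ratioNorm_self [Nonempty b] (hR : R.PosDef) {φ : EuclideanSpace ℂ a} (hφ : ‖φ‖ = 1) :
    ratioNorm R φ φ = 1 := by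
  have hS := sandwich_nonneg (nonneg_iff_posSemidef.2 hR.posSemidef) φ
  have h1 := suppPow_zero_sandwich hR hφ
  rw [ratioNorm]
  conv_lhs => enter [1, 1, 2]; rw [← suppPow_one hS]
  rw [suppPow_mul_suppPow hS, suppPow_mul_suppPow hS,
    show (-1 / 2 + 1 + -1 / 2 : ℝ) = 0 by norm_num, h1, opNorm, map_one, norm_one]

lemma continuous_sandwich (R : Matrix (a × b) (a × b) ℂ) : Continuous (sandwich R) := by
  refine continuous_matrix fun j j' => ?_
  simp only [sandwich, of_apply]
  fun_prop

lemma continuous_opNorm {n : Type*} [Fintype n] [DecidableEq n] :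
    Continuous (opNorm : Matrix n n ℂ → ℝ) :=
  continuous_norm.comp
    (LinearMap.continuous_of_finiteDimensional
      (toEuclideanCLM (n := n) (𝕜 := ℂ)).toAlgEquiv.toLinearMap)

open scoped Matrix.Norms.L2Operator in
lemma continuousOn_suppPow {n : Type*} [Fintype n] [DecidableEq n] {c C : ℝ} (hc : 0 < c) (p : ℝ) :
    ContinuousOn (fun X : Matrix n n ℂ => suppPow X p)
      {X | IsSelfAdjoint X ∧ spectrum ℝ X ⊆ Set.Icc c C} := by
  have h1 : ContinuousOn (fun x : ℝ => if x = 0 then 0 else x ^ p) (Set.Icc c C) := by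
    have : ContinuousOn (fun x : ℝ => x ^ p) (Set.Icc c C) :=
      ContinuousOn.rpow_const continuousOn_id fun x hx => Or.inl (hc.trans_le hx.1).ne'
    exact this.congr fun x hx => by simp [(hc.trans_le hx.1).ne']
  exact continuousOn_cfc (Matrix n n ℂ) isCompact_Icc _ h1

lemma continuousOn_ratioNorm (hR : R.PosDef) :
    ContinuousOn (fun x : EuclideanSpace ℂ a × EuclideanSpace ℂ a => ratioNorm R x.1 x.2)
      {x | ‖x.1‖ = 1} := by
  obtain ⟨c, C, hc, h⟩ := exists_spectrum_sandwich_subset hR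
  have hR0 := nonneg_iff_posSemidef.2 hR.posSemidef
  have h1 : ContinuousOn (fun x : EuclideanSpace ℂ a × EuclideanSpace ℂ a =>
      suppPow (sandwich R x.1) (-1 / 2)) {x | ‖x.1‖ = 1} :=
    (continuousOn_suppPow hc (-1 / 2)).comp
      ((continuous_sandwich R).comp continuous_fst).continuousOn fun x hx =>
        ⟨IsSelfAdjoint.of_nonneg (sandwich_nonneg hR0 x.1), h x.1 hx⟩
  exact continuous_opNorm.comp_continuousOn
    ((h1.mul ((continuous_sandwich R).comp continuous_snd).continuousOn).mul h1)

lemma isGreatest_deltaSet [Nonempty a] {α : ℝ} {ρ : Matrix (a × b) (a × b) ℂ}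
    (hR : (suppPow ρ α).PosDef) : IsGreatest (deltaSet α ρ) (sSup (deltaSet α ρ)) := by
  set K : Set (EuclideanSpace ℂ a × EuclideanSpace ℂ a) :=
    Metric.sphere 0 1 ×ˢ Metric.sphere 0 1 with hK
  have hKc : IsCompact K := (isCompact_sphere _ _).prod (isCompact_sphere _ _)
  have himg : deltaSet α ρ = (fun x : EuclideanSpace ℂ a × EuclideanSpace ℂ a =>
      ratioNorm (suppPow ρ α) x.1 x.2 * ratioNorm (suppPow ρ α) x.2 x.1) '' K := by
    ext m
    constructor
    · rintro ⟨φ, ψ, h1, h2, rfl⟩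
      exact ⟨(φ, ψ), ⟨by simpa using h1, by simpa using h2⟩, rfl⟩
    · rintro ⟨⟨φ, ψ⟩, ⟨h1, h2⟩, rfl⟩
      exact ⟨φ, ψ, by simpa using h1, by simpa using h2, rfl⟩
  have hc1 := continuousOn_ratioNorm hR
  have hcont : ContinuousOn (fun x : EuclideanSpace ℂ a × EuclideanSpace ℂ a =>
      ratioNorm (suppPow ρ α) x.1 x.2 * ratioNorm (suppPow ρ α) x.2 x.1) K := by
    have hmaps : Set.MapsTo Prod.swap K
        {x : EuclideanSpace ℂ a × EuclideanSpace ℂ a | ‖x.1‖ = 1} :=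
      fun x hx => by simpa using hx.2
    have hswap := hc1.comp continuous_swap.continuousOn hmaps
    exact (hc1.mono fun x hx => by simpa using hx.1).mul hswap
  have hne : K.Nonempty := by
    obtain ⟨v, hv⟩ := (NormedSpace.sphere_nonempty (x := (0 : EuclideanSpace ℂ a)) (r := 1)).2
      zero_le_one
    exact ⟨(v, v), hv, hv⟩
  rw [himg]
  exact (hKc.image_of_continuousOn hcont).isGreatest_sSup (hne.image _)

lemma one_le_sSup_deltaSet [Nonempty a] [Nonempty b] {α : ℝ} {ρ : Matrix (a × b) (a × b) ℂ}
    (hR : (suppPow ρ α).PosDef) : 1 ≤ sSup (deltaSet α ρ) := by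
  obtain ⟨v, hv⟩ := (NormedSpace.sphere_nonempty (x := (0 : EuclideanSpace ℂ a)) (r := 1)).2
    zero_le_one
  have hv' : ‖v‖ = 1 := by simpa using hv
  refine (isGreatest_deltaSet hR).2 ⟨v, v, hv', hv', ?_⟩
  rw [ratioNorm_self hR hv', one_mul]

/-- The maximum in the definition of `δ` bounds the cross ratios, by bilinearity in the arguments
and the spectral decomposition. -/
lemma crossRatioLE_partialMap [Nonempty a] {α : ℝ} {ρ : Matrix (a × b) (a × b) ℂ}
    (hR : (suppPow ρ α).PosDef) :
    CrossRatioLE (partialMap (suppPow ρ α)) (sSup (deltaSet α ρ)) := by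
  intro X Y S T hX hY hS hT
  have hR0 := nonneg_iff_posSemidef.2 hR.posSemidef
  have hpure : ∀ φ ψ : EuclideanSpace ℂ a, ‖φ‖ = 1 → ‖ψ‖ = 1 →
      (sandwich (suppPow ρ α) φ * S).trace.re * (sandwich (suppPow ρ α) ψ * T).trace.re ≤
      sSup (deltaSet α ρ) * ((sandwich (suppPow ρ α) φ * T).trace.re *
        (sandwich (suppPow ρ α) ψ * S).trace.re) := by
    intro φ ψ hφ hψ
    have h1 := trace_mul_re_mono (sandwich_le_ratioNorm_smul hR (ψ := φ) hψ) hS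
    have h2 := trace_mul_re_mono (sandwich_le_ratioNorm_smul hR (ψ := ψ) hφ) hT
    rw [Matrix.smul_mul, trace_smul, Complex.smul_re, smul_eq_mul] at h1 h2
    have h3 := trace_mul_re_nonneg (sandwich_nonneg hR0 φ) hT
    have h4 := trace_mul_re_nonneg (sandwich_nonneg hR0 ψ) hS
    have h5 := trace_mul_re_nonneg (sandwich_nonneg hR0 ψ) hT
    have h6 : ratioNorm (suppPow ρ α) φ ψ * ratioNorm (suppPow ρ α) ψ φ ≤ sSup (deltaSet α ρ) :=
      (isGreatest_deltaSet hR).2 ⟨φ, ψ, hφ, hψ, rfl⟩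
    refine (mul_le_mul h1 h2 h5 (mul_nonneg (norm_nonneg _) h4)).trans ?_
    refine le_trans (le_of_eq ?_) (mul_le_mul_of_nonneg_right h6 (mul_nonneg h3 h4))
    ring
  obtain ⟨d, v, hd, hv, rfl⟩ := exists_eq_sum_rankOne hX
  obtain ⟨e, w, he, hw, rfl⟩ := exists_eq_sum_rankOne hY
  have hexp : ∀ (d : a → ℝ) (v : a → EuclideanSpace ℂ a) (S : Matrix b b ℂ),
      (partialMap (suppPow ρ α) (∑ i, d i • vecMulVec (v i).ofLp (star (v i).ofLp)) * S).trace.re =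
        ∑ i, d i * (sandwich (suppPow ρ α) (v i) * S).trace.re := by
    intro d v S
    simp only [map_sum, map_smul, partialMap_rankOne, Finset.sum_mul, trace_sum, Matrix.smul_mul,
      trace_smul, Complex.re_sum, Complex.smul_re, smul_eq_mul]
  rw [hexp, hexp, hexp, hexp, Finset.sum_mul_sum, Finset.sum_mul_sum, Finset.mul_sum]
  refine Finset.sum_le_sum fun i _ => ?_
  rw [Finset.mul_sum]
  refine Finset.sum_le_sum fun j _ => ?_
  have := mul_le_mul_of_nonneg_left (hpure (v i) (w j) (hv i) (hw j)) (mul_nonneg (hd i) (he j))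
  linarith

lemma partialMap_ne_zero [Nonempty b] (hR : R.PosDef) {X : Matrix a a ℂ} (hX : 0 ≤ X)
    (hX0 : X ≠ 0) : partialMap R X ≠ 0 := by
  refine ne_zero_of_dom 
    (partialMap_nonneg (zero_le_one (α := Matrix (a × b) (a × b) ℂ)) hX) ?_
    ((one_dom_of_posDef hR).partialMap_left hX)
  intro h
  have h1 := trace_partialMap_mul (Z := (1 : Matrix (a × b) (a × b) ℂ)) (X := X) (T := 1)
  rw [h, Matrix.zero_mul, trace_zero, Matrix.one_mul, trace_kronecker, trace_one, eq_comm,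
    mul_eq_zero, (nonneg_iff_posSemidef.1 hX).trace_eq_zero_iff] at h1
  rcases h1 with h1 | h1
  · exact hX0 h1
  · simp at h1

lemma posDef_suppPow {n : Type*} [Fintype n] [DecidableEq n] {X : Matrix n n ℂ} (hX : X.PosDef)
    (p : ℝ) : (suppPow X p).PosDef := by
  have h0 := nonneg_iff_posSemidef.2 hX.posSemidef
  rw [(nonneg_iff_posSemidef.1 (suppPow_nonneg h0 p)).posDef_iff_isUnit]
  have h1 : suppPow X 0 = 1 := by
    have h2 : kerProj X = 0 := (hX.isUnit.mul_right_eq_zero).1 (mul_kerProj_self h0)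
    have := suppPow_zero_add_kerProj h0
    rwa [h2, add_zero] at this
  refine IsUnit.of_mul_eq_one (suppPow X (-p)) ?_
  rw [suppPow_mul_suppPow h0, add_neg_cancel, h1]

/-- The cross ratio bound passes to the map in the opposite direction, which is the adjoint. -/
lemma contractsBy_kappa [Nonempty a] [Nonempty b] {α : ℝ} {ρ : Matrix (a × b) (a × b) ℂ}
    (hρ : ρ.PosDef) : ContractsBy (suppPow ρ α) (kappa α ρ) ∧
      ContractsBy (swapSys (suppPow ρ α)) (kappa α ρ) := by
  have hR := posDef_suppPow hρ α
  have hR0 := nonneg_iff_posSemidef.2 hR.posSemidef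
  have hcr := crossRatioLE_partialMap hR
  have hm := one_le_sSup_deltaSet hR
  constructor
  · intro X Y d hX hY hd h
    exact hcr.hilbertLE (fun X hX => partialMap_nonneg hR0 hX)
      (fun X hX hX0 => partialMap_ne_zero hR hX hX0) hm hX hY hd h
  · have hR' : (swapSys (suppPow ρ α)).PosDef := hR.submatrix (Equiv.prodComm b a).injective
    have hcr' : CrossRatioLE (partialMap (swapSys (suppPow ρ α))) (sSup (deltaSet α ρ)) := by
      intro S T X Y hS hT hX hY
      rw [trace_partialMap_swapSys_mul, trace_partialMap_swapSys_mul,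
        trace_partialMap_swapSys_mul, trace_partialMap_swapSys_mul]
      linarith [hcr X Y S T hX hY hS hT]
    intro X Y d hX hY hd h
    exact hcr'.hilbertLE (fun X hX => partialMap_nonneg (swapSys_nonneg hR0) hX)
      (fun X hX hX0 => partialMap_ne_zero hR' hX hX0) hm hX hY hd h

lemma kappa_mem [Nonempty a] [Nonempty b] {α : ℝ} {ρ : Matrix (a × b) (a × b) ℂ}
    (hρ : ρ.PosDef) : 0 ≤ kappa α ρ ∧ kappa α ρ < 1 := by
  have hm := one_le_sSup_deltaSet (posDef_suppPow hρ α)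
  rw [kappa, delta, tanh_log_div_four (by linarith)]
  have : 1 ≤ √(sSup (deltaSet α ρ)) := Real.one_le_sqrt.2 hm
  refine ⟨div_nonneg (by linarith) (by linarith), ?_⟩
  rw [div_lt_one (by linarith)]
  linarith

end Diameter

/-- The linear bound on the error implies the exponential one by `z ≤ exp z - 1`. -/
lemma bound_and_isBigO {x : ℕ → ℝ} {I d r p : ℝ} (hp : 0 < p) (hr : 0 ≤ r)
    (h : ∀ n, |x n - I| ≤ (1 + r) * r ^ (2 * n) * d) :
    (∀ n : ℕ, |x n - I| ≤ 1 / p * (Real.exp (p * (1 + r) * r ^ (2 * n) * d) - 1)) ∧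
      Asymptotics.IsBigO Filter.atTop (fun n : ℕ => x n - I) (fun n : ℕ => r ^ (2 * n)) := by
  constructor
  · intro n
    refine (h n).trans ?_
    have := Real.add_one_le_exp (p * (1 + r) * r ^ (2 * n) * d)
    rw [one_div, ← div_eq_inv_mul, le_div_iff₀ hp]
    linarith
  · refine Asymptotics.IsBigO.of_bound ((1 + r) * d) (Filter.Eventually.of_forall fun n => ?_)
    rw [Real.norm_eq_abs, Real.norm_of_nonneg (by positivity)]
    refine (h n).trans_eq ?_
    ring

end PetzMI

open PetzMI
theorem corollary2 {a b : Type*} [Fintype a] [DecidableEq a] [Fintype b] [DecidableEq b]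
    (α : ℝ) (hα : 1 < α) (hα' : α ≤ 2)
    (ρ : Matrix (a × b) (a × b) ℂ) (hρ : IsState ρ)
    (σhat : Matrix a a ℂ) (τhat : Matrix b b ℂ) (hmin : IsMinimizer α ρ σhat τhat)
    (σ₀ : Matrix a a ℂ) (hσ₀ : IsState σ₀) (hsupp : SameSupport σ₀ (trB ρ))
    (γ : ℝ) (hγ : γ = |1 - 1 / α|) :
    -- the extended-valued quantities below are finite
    ∃ (x : ℕ → ℝ) (I d : ℝ),
      (∀ n, objVal α ρ σ₀ n = (x n : EReal)) ∧ prmi α ρ = (I : EReal) ∧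
      dH σ₀ σhat = (d : EReal) ∧
      -- the general bound
      ((∀ n : ℕ, |x n - I| ≤
          1 / |α - 1| * (Real.exp (|α - 1| * (1 + γ) * γ ^ (2 * n) * d) - 1)) ∧
        Asymptotics.IsBigO Filter.atTop (fun n : ℕ => x n - I) (fun n : ℕ => γ ^ (2 * n))) ∧
      -- the improved bound for positive definite states
      (ρ.PosDef →
        IsGreatest (deltaSet α ρ) (sSup (deltaSet α ρ)) ∧
        0 ≤ kappa α ρ ∧ kappa α ρ < 1 ∧
        (∀ n : ℕ, |x n - I| ≤
          1 / |α - 1| *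
            (Real.exp (|α - 1| * (1 + γ * kappa α ρ) * (γ * kappa α ρ) ^ (2 * n) * d) - 1)) ∧
        Asymptotics.IsBigO Filter.atTop (fun n : ℕ => x n - I)
          (fun n : ℕ => (γ * kappa α ρ) ^ (2 * n))) := by
  have hγ0 : 0 ≤ 1 - 1 / α := by
    rw [sub_nonneg, div_le_one (by linarith)]
    exact hα.le
  rw [abs_of_nonneg hγ0] at hγ
  subst hγ
  have hp : 0 < α - 1 := by linarith
  rw [abs_of_pos hp]
  have hd₀ := (sameSupport_iff_dom hσ₀.nonneg hρ.trB.nonneg).1 hsupp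
  have hτdom : Dom (trB (swapSys ρ)) τhat := (hmin.dom hα hρ).2
  have hσdom : Dom σhat (trB ρ) := by
    have h := (stepAB_dom (α := α) hρ.swapSys hmin.2.1.nonneg hτdom).2
    rwa [← stepBA_eq α hρ.nonneg, ← hmin.eq_stepBA hα hρ, trA_swapSys] at h
  obtain ⟨d, hd0, hd, hH⟩ := exists_dH_eq hσ₀.nonneg hσ₀.ne_zero hmin.1.nonneg hmin.1.ne_zero
    (hd₀.1.trans (hmin.dom hα hρ).1) (hσdom.trans hd₀.2)
  obtain ⟨x, I, hx, hI, hbound⟩ := exists_objVal_bound hα hα' hρ hmin hσ₀ hd₀.2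
  have hR := suppPow_nonneg hρ.nonneg α
  refine ⟨x, I, d, hx, hI, hd, ?_, fun hpos => ?_⟩
  · have h := hbound 1 d (contractsBy_one hR) (contractsBy_one (swapSys_nonneg hR)) zero_le_one
      hd0 hH
    rw [mul_one] at h
    exact bound_and_isBigO hp hγ0 h
  · obtain ⟨i, j⟩ : Nonempty (a × b) := by
      by_contra hempty
      rw [not_nonempty_iff] at hempty
      exact hρ.ne_zero (Subsingleton.elim _ _)
    have : Nonempty a := ⟨i⟩
    have : Nonempty b := ⟨j⟩
    obtain ⟨hκ0, hκ1⟩ := kappa_mem (α := α) hpos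
    have hκ := contractsBy_kappa (α := α) hpos
    exact ⟨isGreatest_deltaSet (posDef_suppPow hpos α), hκ0, hκ1,
      bound_and_isBigO hp (mul_nonneg hγ0 hκ0) (hbound _ d hκ.1 hκ.2 hκ0 hd0 hH)⟩
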